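/- Let $F$ be a field, $D$ a subring of $F$, and let $Z$ be a set of valuation rings of $F$ that contain $D$, with $F\in Z$. Give $Z$ the topology whose basic open sets are $\{V\in Z: u_1,\ldots,u_m\in V\}$ ($u_1,\ldots,u_m\in F$) and the sheaf of rings with $\mathcal O_Z(U)=\bigcap_{V\in U}V$ for nonempty open $U$ and $\mathcal O_Z(\emptyset)=0$; thus $Z$ is a locally ringed space. It lies over $\mathrm{Spec}(D)$ by the morphism that sends $V$ to its center in $D$ and is inclusion on sections. Let $n\ge 0$ and $\mathbb P^n_D=\mathrm{Proj}(D[T_0,\ldots,T_n])$. A $D$-morphism is a morphism of locally ringed spaces that is compatible with the structure morphisms to $\mathrm{Spec}(D)$. For $t_0,\ldots,t_n\in F$, not all zero, put $D_i=D[t_0/t_i,\ldots,t_n/t_i]$ for each $i$ with $t_i\neq 0$. The projective model of $F/D$ defined by $t_0,\ldots,t_n$ is the set $X=\{(D_i)_P : t_i\ne 0,\ P\in\mathrm{Spec}(D_i)\}$ of local subrings of $F$, with the topology whose basic open sets are $\{R\in X:u_1,\ldots,u_m\in R\}$ and with $\mathcal O_X(U)=\bigcap_{R\in U}R$ for nonempty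 open $U$, $\mathcal O_X(\emptyset)=0$. Each $V\in Z$ dominates exactly one local ring in $X$; sending $V$ to this ring, and taking inclusions on sections, gives the domination morphism $\delta:Z\to X$. Let $\gamma:X\to\mathbb P^n_D$ be the morphism (a closed immersion) glued from the morphisms $\mathrm{Spec}(D_i)\to\mathrm{Spec}(D[T_0/T_i,\ldots,T_n/T_i])\subseteq\mathbb P^n_D$, $t_i\neq0$, that are induced by the $D$-algebra homomorphisms $T_j/T_i\mapsto t_j/t_i$, where $\mathrm{Spec}(D_i)$ is identified with the open set $\{(D_i)_P:P\in\mathrm{Spec}(D_i)\}$ of $X$. The composite $\gamma\circ\delta:Z\to\mathbb P^n_D$ is called the morphism defined by $t_0,\ldots,t_n$. **Proposition.** For every $D$-morphism $\phi:Z\to\mathbb P^n_D$ there exist $t_0,\ldots,t_n\in F$, not all zero, such that $\phi$ is the morphism defined by $t_0,\ldots,t_n$. -/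

import Mathlib

open CategoryTheory AlgebraicGeometry

universe u

noncomputable section

open TopologicalSpace Opposite

/-! ### Spaces of local subrings of a field

A family `r` of local subrings of a field `F` is made into a locally ringed space: the topology is
the Zariski topology, and the ring of sections over a nonempty open set is the intersection of the
local rings in it. Both sets of valuation rings and projective models are such spaces. -/

namespace LocalRingSpace

section

variable {F : Type u} [Field F] {ι : Type u}

/-- The set of points of the space attached to the family `r`. -/
def Points (_r : ι → LocalSubring F) : Type u := ι

/-- The Zariski topology: the basic open sets are the sets of all local rings in the family that
contain a given finite set of elements of `F`. -/
instance zariskiTopology (r : ι → LocalSubring F) : TopologicalSpace (Points r) :=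
  TopologicalSpace.generateFrom
    {U | ∃ s : Finset F, U = {x : Points r | ∀ u ∈ s, u ∈ (r x).toSubring}}

/-- The underlying topological space. -/
abbrev top (r : ι → LocalSubring F) : TopCat.{u} := TopCat.of (Points r)

/-- Some ring of the family contains all the others. It then lies in every nonempty open set, so that
the space is irreducible. -/
def HasGenericPoint (r : ι → LocalSubring F) : Prop :=
  ∃ η, ∀ x, (r x).toSubring ≤ (r η).toSubring

theorem isOpen_setOf_mem (r : ι → LocalSubring F) (u : F) :
    IsOpen {x : Points r | u ∈ (r x).toSubring} :=
  TopologicalSpace.isOpen_generateFrom_of_mem ⟨{u}, by simp⟩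

theorem generic_mem_of_isOpen {r : ι → LocalSubring F} {η : ι}
    (hη : ∀ x, (r x).toSubring ≤ (r η).toSubring) {U : Set (Points r)} (hU : IsOpen U)
    {x : Points r} (hx : x ∈ U) : (η : Points r) ∈ U := by
  induction hU generalizing x with
  | basic s hs =>
    obtain ⟨s, rfl⟩ := hs
    exact fun u hu => hη x (hx u hu)
  | univ => trivial
  | inter s t _ _ h1 h2 => exact ⟨h1 hx.1, h2 hx.2⟩
  | sUnion S _ h =>
    obtain ⟨s, hs, hx⟩ := hx
    exact ⟨s, hs, h s hs hx⟩

/-- Sections over `U` as functions: a section is an element of `F` that lies in all the local rings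
in `U`, written as a constant function on `U`. So the sections over a nonempty `U` are the
intersection of the local rings in `U`, and there is exactly one section over the empty set. -/
def isSection (r : ι → LocalSubring F) (h : HasGenericPoint r) :
    TopCat.LocalPredicate (X := top r) fun _ => F where
  pred {U} s := (∀ x : U, s x ∈ (r x.1).toSubring) ∧ ∀ x y : U, s x = s y
  res i _ hs := ⟨fun x => hs.1 ⟨x.1, i.le x.2⟩, fun x y => hs.2 ⟨x.1, i.le x.2⟩ ⟨y.1, i.le y.2⟩⟩
  locality {U} s hs := by
    obtain ⟨η, hη⟩ := h
    refine ⟨fun x => ?_, fun x y => ?_⟩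
    · obtain ⟨V, hx, i, h⟩ := hs x
      exact h.1 ⟨x.1, hx⟩
    · have hηU : (η : Points r) ∈ U := generic_mem_of_isOpen hη U.2 x.2
      have key : ∀ z : U, s z = s ⟨η, hηU⟩ := fun z => by
        obtain ⟨V, hz, i, h⟩ := hs z
        exact h.2 ⟨z.1, hz⟩ ⟨η, generic_mem_of_isOpen hη V.2 hz⟩
      rw [key x, key y]

/-- The ring of sections over `U`. -/
def sections (r : ι → LocalSubring F) (U : Opens (top r)) : Subring (U → F) where
  carrier := {s | (∀ x : U, s x ∈ (r x.1).toSubring) ∧ ∀ x y : U, s x = s y}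
  zero_mem' := ⟨fun _ => zero_mem _, fun _ _ => rfl⟩
  one_mem' := ⟨fun _ => one_mem _, fun _ _ => rfl⟩
  add_mem' ha hb := ⟨fun x => add_mem (ha.1 x) (hb.1 x),
    fun x y => congrArg₂ (· + ·) (ha.2 x y) (hb.2 x y)⟩
  neg_mem' ha := ⟨fun x => neg_mem (ha.1 x), fun x y => congrArg Neg.neg (ha.2 x y)⟩
  mul_mem' ha hb := ⟨fun x => mul_mem (ha.1 x) (hb.1 x),
    fun x y => congrArg₂ (· * ·) (ha.2 x y) (hb.2 x y)⟩

/-- The structure presheaf; off the empty set the restriction maps are inclusions. -/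
def presheaf (r : ι → LocalSubring F) : TopCat.Presheaf CommRingCat.{u} (top r) where
  obj U := CommRingCat.of (sections r U.unop)
  map {U V} i := CommRingCat.ofHom
    { toFun s := ⟨fun x => s.1 ⟨x.1, i.unop.le x.2⟩,
        fun x => s.2.1 ⟨x.1, i.unop.le x.2⟩, fun _ _ => s.2.2 _ _⟩
      map_zero' := rfl
      map_add' _ _ := rfl
      map_one' := rfl
      map_mul' _ _ := rfl }

theorem presheaf_isSheaf (r : ι → LocalSubring F) (h : HasGenericPoint r) :
    (presheaf r).IsSheaf := by
  rw [TopCat.Presheaf.isSheaf_iff_isSheaf_comp (forget CommRingCat)]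
  exact TopCat.Presheaf.isSheaf_of_iso
    (show (TopCat.subsheafToTypes (isSection r h)).1 ≅ presheaf r ⋙ forget CommRingCat from
      NatIso.ofComponents (fun _ => Iso.refl _) (by intros; rfl))
    (TopCat.subsheafToTypes (isSection r h)).2

/-- The ringed space attached to the family. -/
def sheafedSpace (r : ι → LocalSubring F) (h : HasGenericPoint r) :
    SheafedSpace CommRingCat.{u} where
  carrier := top r
  presheaf := presheaf r
  IsSheaf := presheaf_isSheaf r h

/-- The value of a section at a point. -/
def eval (r : ι → LocalSubring F) (U : Opens (top r)) (x : top r) (hx : x ∈ U) :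
    (presheaf r).obj (op U) ⟶ CommRingCat.of (r x).toSubring :=
  CommRingCat.ofHom
    { toFun s := ⟨s.1 ⟨x, hx⟩, s.2.1 ⟨x, hx⟩⟩
      map_one' := rfl
      map_mul' _ _ := rfl
      map_zero' := rfl
      map_add' _ _ := rfl }

/-- The value at a point of a germ. -/
def stalkEval (r : ι → LocalSubring F) (x : top r) :
    (presheaf r).stalk x ⟶ CommRingCat.of (r x).toSubring :=
  Limits.colimit.desc ((OpenNhds.inclusion x).op ⋙ presheaf r)
    { pt := _
      ι := { app := fun U => eval r ((OpenNhds.inclusion _).obj U.unop) x U.unop.2 } }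

theorem germ_stalkEval (r : ι → LocalSubring F) (U : Opens (top r)) (x : top r) (hx : x ∈ U) :
    (presheaf r).germ U x hx ≫ stalkEval r x = eval r U x hx :=
  Limits.colimit.ι_desc _ _

theorem stalkEval_germ (r : ι → LocalSubring F) (U : Opens (top r)) (x : top r) (hx : x ∈ U)
    (s : (presheaf r).obj (op U)) :
    ((stalkEval r x).hom ((presheaf r).germ U x hx s) : F) = s.1 ⟨x, hx⟩ :=
  congrArg Subtype.val
    (RingHom.ext_iff.1 (CommRingCat.hom_ext_iff.mp (germ_stalkEval r U x hx)) s)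

theorem eval_germ (r : ι → LocalSubring F) (U : Opens (top r)) (x : top r) (hx : x ∈ U)
    (s : (presheaf r).obj (op U)) :
    (stalkEval r x).hom ((presheaf r).germ U x hx s) = ⟨s.1 ⟨x, hx⟩, s.2.1 ⟨x, hx⟩⟩ :=
  Subtype.ext (stalkEval_germ r U x hx s)

theorem stalkEval_bijective (r : ι → LocalSubring F) (x : top r) :
    Function.Bijective (stalkEval r x).hom := by
  constructor
  · intro a b hab
    obtain ⟨U, hxU, s, rfl⟩ := (presheaf r).exists_germ_eq a
    obtain ⟨V, hxV, t, rfl⟩ := (presheaf r).exists_germ_eq b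
    have h := congrArg Subtype.val hab
    rw [stalkEval_germ, stalkEval_germ] at h
    refine (presheaf r).germ_ext (U ⊓ V) ⟨hxU, hxV⟩ (homOfLE inf_le_left) (homOfLE inf_le_right) ?_
    apply Subtype.ext
    funext y
    exact (s.2.2 ⟨y.1, y.2.1⟩ ⟨x, hxU⟩).trans (h.trans (t.2.2 ⟨x, hxV⟩ ⟨y.1, y.2.2⟩))
  · intro a
    let U : Opens (top r) := ⟨_, isOpen_setOf_mem r a.1⟩
    refine ⟨(presheaf r).germ U x a.2 ⟨fun _ => a.1, fun y => y.2, fun _ _ => rfl⟩, ?_⟩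
    apply Subtype.ext
    exact stalkEval_germ r U x a.2 _

/-- The stalk at a point is the local ring of the family at that point. -/
def stalkEquiv (r : ι → LocalSubring F) (x : top r) :
    (presheaf r).stalk x ≃+* (r x).toSubring :=
  RingEquiv.ofBijective _ (stalkEval_bijective r x)

end

end LocalRingSpace

open LocalRingSpace

/-- The locally ringed space attached to a family of local subrings of `F`. -/
def localRingSpace {F : Type u} [Field F] {ι : Type u} (r : ι → LocalSubring F)
    (h : HasGenericPoint r) : LocallyRingedSpace.{u} where
  toSheafedSpace := sheafedSpace r h
  isLocalRing x := (stalkEquiv r x).symm.isLocalRing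

namespace LocalRingSpace

section

variable {F : Type u} [Field F]

theorem mem_ofPrime (A : Subring F) (P : Ideal A) [P.IsPrime] (u : F) :
    u ∈ (LocalSubring.ofPrime A P).toSubring ↔ ∃ a b : A, b ∉ P ∧ u = a / b := by
  constructor
  · intro hu
    obtain ⟨⟨a, b⟩, h⟩ := IsLocalization.surj P.primeCompl
      (⟨u, hu⟩ : (LocalSubring.ofPrime A P).toSubring)
    refine ⟨a, b.1, b.2, ?_⟩
    have hb : (b.1 : F) ≠ 0 := fun h0 => b.2 (by
      have h1 : b.1 = 0 := Subtype.ext h0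
      rw [h1]; exact P.zero_mem)
    rw [eq_div_iff hb]
    exact congrArg Subtype.val h
  · rintro ⟨a, b, hb, rfl⟩
    have hb0 : (b : F) ≠ 0 := fun h0 => hb (by
      have h1 : b = 0 := Subtype.ext h0
      rw [h1]; exact P.zero_mem)
    have h := IsLocalization.mk'_spec (LocalSubring.ofPrime A P).toSubring a
      (⟨b, hb⟩ : P.primeCompl)
    have h' : ((IsLocalization.mk' (LocalSubring.ofPrime A P).toSubring a
      (⟨b, hb⟩ : P.primeCompl) : (LocalSubring.ofPrime A P).toSubring) : F) * b = a :=
      congrArg Subtype.val h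
    rw [← eq_div_iff hb0] at h'
    rw [← h']
    exact Subtype.property _

theorem inv_mem_of_le {R S : LocalSubring F} (h : R ≤ S) {u : F} (hu : u ∈ R.toSubring)
    (hu0 : u ≠ 0) (hu' : u⁻¹ ∈ S.toSubring) : u⁻¹ ∈ R.toSubring := by
  obtain ⟨hle, hloc⟩ := h
  have hunit : IsUnit (Subring.inclusion hle ⟨u, hu⟩) :=
    IsUnit.of_mul_eq_one ⟨u⁻¹, hu'⟩ (Subtype.ext (mul_inv_cancel₀ hu0))
  obtain ⟨v, hv⟩ := (hloc.map_nonunit _ hunit).exists_right_inv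
  have : u * (v : F) = 1 := congrArg Subtype.val hv
  rw [inv_eq_of_mul_eq_one_right this]
  exact v.2

theorem ofPrime_toSubring_le {A : Subring F} {P : Ideal A} [P.IsPrime] {R S : LocalSubring F}
    (h : LocalSubring.ofPrime A P ≤ S) (hR : R ≤ S) (hA : A ≤ R.toSubring) :
    (LocalSubring.ofPrime A P).toSubring ≤ R.toSubring := by
  intro u hu
  obtain ⟨a, b, hb, rfl⟩ := (mem_ofPrime A P u).1 hu
  by_cases hb0 : (b : F) = 0
  · simp [hb0]
  rw [div_eq_mul_inv]
  refine mul_mem (hA a.2) (inv_mem_of_le hR (hA b.2) hb0 (h.1 ?_))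
  exact (mem_ofPrime A P _).2 ⟨1, b, hb, by simp⟩

theorem exists_ofPrime_le {A : Subring F} {S : LocalSubring F} (hA : A ≤ S.toSubring) :
    ∃ P : PrimeSpectrum A, LocalSubring.ofPrime A P.asIdeal ≤ S := by
  let P : PrimeSpectrum A :=
    PrimeSpectrum.comap (Subring.inclusion hA) (IsLocalRing.closedPoint S.toSubring)
  have key : ∀ b : A, b ∉ P.asIdeal → (b : F) ≠ 0 ∧ (b : F)⁻¹ ∈ S.toSubring := by
    intro b hb
    have hu : IsUnit (Subring.inclusion hA b) := by
      by_contra hn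
      exact hb hn
    obtain ⟨v, hv⟩ := hu.exists_right_inv
    have : (b : F) * (v : F) = 1 := congrArg Subtype.val hv
    refine ⟨left_ne_zero_of_mul_eq_one this, ?_⟩
    rw [inv_eq_of_mul_eq_one_right this]
    exact v.2
  have hle : (LocalSubring.ofPrime A P.asIdeal).toSubring ≤ S.toSubring := by
    intro u hu
    obtain ⟨a, b, hb, rfl⟩ := (mem_ofPrime A P.asIdeal u).1 hu
    rw [div_eq_mul_inv]
    exact mul_mem (hA a.2) (key b hb).2
  refine ⟨P, hle, ⟨?_⟩⟩
  rintro ⟨u, hu⟩ h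
  obtain ⟨a, b, hb, rfl⟩ := (mem_ofPrime A P.asIdeal u).1 hu
  have ha : a ∉ P.asIdeal := by
    intro ha
    have h2 : IsUnit (Subring.inclusion hA a) := by
      have h3 : IsUnit (Subring.inclusion hA b) := by
        by_contra hn
        exact hb hn
      have h4 := h.mul h3
      convert h4 using 1
      exact Subtype.ext (div_mul_cancel₀ _ (key b hb).1).symm
    exact ha h2
  refine IsUnit.of_mul_eq_one ⟨(b : F) / a, (mem_ofPrime A P.asIdeal _).2 ⟨b, a, ha, rfl⟩⟩ ?_
  exact Subtype.ext (by
    have h1 := (key a ha).1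
    have h2 := (key b hb).1
    change (a : F) / b * (b / a) = 1
    field_simp)

end

end LocalRingSpace

/-- Let `d` be a continuous map that sends each local ring `r x` to a local ring `q (d x)` that it
dominates (this is the order on `LocalSubring F`). The morphism of locally ringed spaces that is `d`
on points and inclusion of subrings of `F` on sections. -/
def dominationHom {F : Type u} [Field F] {ι κ : Type u} {r : ι → LocalSubring F}
    {q : κ → LocalSubring F} (hr : HasGenericPoint r) (hq : HasGenericPoint q)
    (d : C(Points r, Points q)) (hd : ∀ x, q (d x) ≤ r x) :
    localRingSpace r hr ⟶ localRingSpace q hq where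
  base := TopCat.ofHom d
  c :=
    { app U := CommRingCat.ofHom
        { toFun s := ⟨fun x => s.1 ⟨d x.1, x.2⟩, fun x => (hd x.1).1 (s.2.1 ⟨d x.1, x.2⟩),
            fun _ _ => s.2.2 _ _⟩
          map_zero' := rfl
          map_add' _ _ := rfl
          map_one' := rfl
          map_mul' _ _ := rfl } }
  prop x := by
    constructor
    intro a ha
    obtain ⟨U, hxU, s, rfl⟩ := (presheaf q).exists_germ_eq a
    erw [PresheafedSpace.stalkMap_germ_apply] at ha
    have h1 := ha.map (stalkEval r x).hom
    erw [LocalRingSpace.eval_germ] at h1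
    have h2 : IsUnit (Subring.inclusion (hd x).1 ⟨s.1 ⟨d x, hxU⟩, s.2.1 ⟨d x, hxU⟩⟩) := h1
    have h3 := (hd x).2.map_nonunit _ h2
    refine (isUnit_map_iff (stalkEquiv q (d x)) _).1 ?_
    convert h3
    exact LocalRingSpace.stalkEval_germ q U (d x) hxU s

namespace LocalRingSpace

section

variable {F : Type u} [Field F] {ι : Type u}

theorem continuous_of_eq_ofPrime {A : Subring F} {r : ι → LocalSubring F}
    (d : PrimeSpectrum A → Points r) (hd : ∀ P, r (d P) = LocalSubring.ofPrime A P.asIdeal) :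
    Continuous d := by
  refine continuous_generateFrom_iff.2 ?_
  rintro _ ⟨s, rfl⟩
  rw [isOpen_iff_forall_mem_open]
  intro P hP
  have h1 : ∀ u ∈ s, ∃ b : A, b ∉ P.asIdeal ∧ ∀ Q : PrimeSpectrum A, b ∉ Q.asIdeal →
      u ∈ (r (d Q)).toSubring := by
    intro u hu
    have h2 := hP u hu
    rw [hd, mem_ofPrime] at h2
    obtain ⟨a, b, hb, rfl⟩ := h2
    refine ⟨b, hb, fun Q hQ => ?_⟩
    rw [hd, mem_ofPrime]
    exact ⟨a, b, hQ, rfl⟩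
  choose! b hb hb' using h1
  refine ⟨⋂ u ∈ s, (PrimeSpectrum.basicOpen (b u) : Set (PrimeSpectrum A)), ?_, ?_, ?_⟩
  · intro Q hQ u hu
    exact hb' u hu Q (Set.mem_iInter₂.1 hQ u hu)
  · exact isOpen_biInter_finset fun u _ => (PrimeSpectrum.basicOpen (b u)).isOpen
  · exact Set.mem_iInter₂.2 fun u hu => hb u hu

theorem exists_eq_div {A : Subring F} (P : PrimeSpectrum A) {u : F}
    (hu : u ∈ (LocalSubring.ofPrime A P.asIdeal).toSubring) :
    ∃ a b : A, b ∉ P.asIdeal ∧ u = a / b :=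
  (mem_ofPrime A P.asIdeal u).1 hu

/-- The subring `A_P` of `F` is the localization of `A` at `P`. -/
def localizationEquiv (A : Subring F) (P : PrimeSpectrum A) :
    (LocalSubring.ofPrime A P.asIdeal).toSubring ≃ₐ[A] LocalizedModule P.asIdeal.primeCompl A :=
  IsLocalization.algEquiv P.asIdeal.primeCompl _ _

theorem localizationEquiv_eq_mk (A : Subring F) (P : PrimeSpectrum A)
    (u : (LocalSubring.ofPrime A P.asIdeal).toSubring) (a b : A) (hb : b ∉ P.asIdeal)
    (h : (u : F) = a / b) : localizationEquiv A P u = LocalizedModule.mk a ⟨b, hb⟩ := by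
  have hb0 : (b : F) ≠ 0 := fun h0 => hb (by
    have h1 : b = 0 := Subtype.ext h0
    rw [h1]; exact P.asIdeal.zero_mem)
  have h1 : b • u = algebraMap A _ a := Subtype.ext (by
    change (b : F) * u = a
    rw [h]
    field_simp)
  have h2 := congrArg (localizationEquiv A P) h1
  rw [map_smul, AlgEquiv.commutes] at h2
  have h3 : b • (LocalizedModule.mk a ⟨b, hb⟩ : LocalizedModule P.asIdeal.primeCompl A) =
      algebraMap A _ a := by
    rw [LocalizedModule.smul'_mk]
    change _ = LocalizedModule.mk a 1
    exact LocalizedModule.mk_cancel (s := (⟨b, hb⟩ : P.asIdeal.primeCompl)) a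
  have h4 := h2.trans h3.symm
  rw [Algebra.smul_def, Algebra.smul_def] at h4
  exact (IsLocalization.map_units _ (⟨b, hb⟩ : P.asIdeal.primeCompl)).mul_left_cancel h4

/-- The value in `A_P` of a section, at a point whose local ring is `A_P`. -/
def specEval {A : Subring F} {r : ι → LocalSubring F} (U : Opens (top r)) (x : top r)
    (hx : x ∈ U) (P : PrimeSpectrum A) (hP : r x = LocalSubring.ofPrime A P.asIdeal) :
    sections r U →+* LocalizedModule P.asIdeal.primeCompl A :=
  (localizationEquiv A P).toRingEquiv.toRingHom.comp
    { toFun s := ⟨s.1 ⟨x, hx⟩, hP ▸ s.2.1 ⟨x, hx⟩⟩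
      map_one' := rfl
      map_mul' _ _ := rfl
      map_zero' := rfl
      map_add' _ _ := rfl }

/-- A section `u` over `U` as a section of the structure sheaf of `Spec A`: its value at each `P`
is `u`, an element of `A_P`. -/
def specApp {A : Subring F} {r : ι → LocalSubring F} (d : PrimeSpectrum.Top A ⟶ top r)
    (hd : ∀ P : PrimeSpectrum A, r (d P) = LocalSubring.ofPrime A P.asIdeal) (U : Opens (top r)) :
    sections r U →+* (structureSheafInType A A).obj.obj (op ((Opens.map d).obj U)) where
  toFun s := ⟨fun P => specEval U (d P.1) P.2 P.1 (hd P.1) s, by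
    intro P
    obtain ⟨a, b, hb, h⟩ := exists_eq_div (u := s.1 ⟨d P.1, P.2⟩) P.1 (by
      rw [← hd P.1]
      exact s.2.1 ⟨d P.1, P.2⟩)
    refine ⟨(Opens.map d).obj U ⊓ PrimeSpectrum.basicOpen b, ⟨P.2, hb⟩, homOfLE inf_le_left,
      a, b, fun Q => ⟨Q.2.2, ?_⟩⟩
    exact localizationEquiv_eq_mk A Q.1 _ a b Q.2.2 ((s.2.2 _ _).trans h)⟩
  map_zero' := Subtype.ext (funext fun P => map_zero (specEval U (d P.1) P.2 P.1 (hd P.1)))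
  map_add' s t := Subtype.ext (funext fun P => map_add (specEval U (d P.1) P.2 P.1 (hd P.1)) s t)
  map_one' := Subtype.ext (funext fun P => map_one (specEval U (d P.1) P.2 P.1 (hd P.1)))
  map_mul' s t := Subtype.ext (funext fun P => map_mul (specEval U (d P.1) P.2 P.1 (hd P.1)) s t)

/-- The map `specApp` in the category of rings. -/
def specAppHom {A : Subring F} {r : ι → LocalSubring F} (d : PrimeSpectrum.Top A ⟶ top r)
    (hd : ∀ P : PrimeSpectrum A, r (d P) = LocalSubring.ofPrime A P.asIdeal) (U : Opens (top r)) :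
    CommRingCat.of (sections r U) ⟶
      (Spec.structureSheaf (CommRingCat.of A)).presheaf.obj (op ((Opens.map d).obj U)) :=
  CommRingCat.ofHom (S := (structureSheafInType A A).obj.obj (op ((Opens.map d).obj U)))
    (specApp d hd U)

end

end LocalRingSpace

/-- Let `d` be a map that sends each prime `P` of the subring `A` to a point with local ring `A_P`.
The morphism of locally ringed spaces from `Spec A` that is `d` on points and inclusion of subrings
of `F` on sections. -/
def specHom {F : Type u} [Field F] {ι : Type u} (A : Subring F) {r : ι → LocalSubring F}
    (hr : HasGenericPoint r) (d : PrimeSpectrum A → Points r)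
    (hd : ∀ P, r (d P) = LocalSubring.ofPrime A P.asIdeal) :
    (Spec (CommRingCat.of A)).toLocallyRingedSpace ⟶ localRingSpace r hr where
  base := TopCat.ofHom ⟨d, continuous_of_eq_ofPrime d hd⟩
  c := 
    { app U := specAppHom (TopCat.ofHom ⟨d, continuous_of_eq_ofPrime d hd⟩) hd U.unop
      naturality _ _ _ := rfl }
  prop := fun (x : PrimeSpectrum A) => by
    constructor
    intro a ha
    obtain ⟨U, hxU, s, rfl⟩ := (presheaf r).exists_germ_eq a
    erw [PresheafedSpace.stalkMap_germ_apply] at ha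
    obtain ⟨W, i, hxW, hu⟩ := RingedSpace.isUnit_res_of_isUnit_germ
      (Spec (CommRingCat.of A)).toLocallyRingedSpace.toRingedSpace _ _ x hxU ha
    obtain ⟨τ, hτ⟩ := hu.exists_right_inv
    have h1 := congrArg (fun σ : (structureSheafInType A A).obj.obj (op W) => σ.1 ⟨x, hxW⟩) hτ
    have h2 : IsUnit (specEval U (d x) hxU x (hd x) s) := IsUnit.of_mul_eq_one _ h1
    have h3 : IsUnit (⟨s.1 ⟨d x, hxU⟩, hd x ▸ s.2.1 ⟨d x, hxU⟩⟩ :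
        (LocalSubring.ofPrime A x.asIdeal).toSubring) :=
      (isUnit_map_iff (localizationEquiv A x) _).1 h2
    refine (isUnit_map_iff (stalkEquiv r (d x)) _).1 ?_
    obtain ⟨v, hv⟩ := h3.exists_right_inv
    refine IsUnit.of_mul_eq_one ⟨v.1, by rw [hd x]; exact v.2⟩ (Subtype.ext ?_)
    refine (congrArg (· * v.1) (stalkEval_germ r U (d x) hxU s)).trans ?_
    exact congrArg Subtype.val hv

/-- Let `A` be a subring of all the local rings of the family. The morphism to `Spec A` that
corresponds, by the universal property of `Spec A`, to the inclusion of `A` into the ring of global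
sections. On points it sends a local ring to its center in `A`, that is, to the intersection of `A`
with its maximal ideal, and on sections it is inclusion of subrings of `F`. -/
def centerHom {F : Type u} [Field F] {ι : Type u} (A : Subring F) {r : ι → LocalSubring F}
    (hr : HasGenericPoint r) (hA : ∀ x, A ≤ (r x).toSubring) :
    localRingSpace r hr ⟶ (Spec (CommRingCat.of A)).toLocallyRingedSpace :=
  (localRingSpace r hr).toΓSpec ≫ Spec.locallyRingedSpaceMap
    (R := CommRingCat.of A) (S := LocallyRingedSpace.Γ.obj (op (localRingSpace r hr)))
    (CommRingCat.ofHom (R := A) (S := sections r ⊤)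
      { toFun a := ⟨fun _ => a, fun x => hA x.1 a.2, fun _ _ => rfl⟩
        map_one' := rfl
        map_mul' _ _ := rfl
        map_zero' := rfl
        map_add' _ _ := rfl })

/-! ### Sets of valuation rings -/

section Zariski

variable {F : Type u} [Field F]

/-- The Zariski-Riemann space of `F/D`, as a set: all valuation rings of `F` that contain `D`. -/
def zariskiRiemann (D : Subring F) : Set (ValuationSubring F) :=
  {V | D ≤ V.toSubring}

/-- The valuation rings in `Z`, as local subrings of `F`. -/
def zariskiFamily (Z : Set (ValuationSubring F)) : Z → LocalSubring F :=
  fun V => V.1.toLocalSubring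

theorem zariskiFamily_hasGenericPoint {Z : Set (ValuationSubring F)} (hF : ⊤ ∈ Z) :
    HasGenericPoint (zariskiFamily Z) :=
  ⟨⟨⊤, hF⟩, fun _ _ _ => trivial⟩

/-- The set `Z` of valuation rings (with `F` in `Z`) as a locally ringed space, with the topology
induced by the Zariski-Riemann space and the holomorphy sheaf. -/
abbrev zariskiSpace (Z : Set (ValuationSubring F)) (hF : ⊤ ∈ Z) : LocallyRingedSpace.{u} :=
  localRingSpace (zariskiFamily Z) (zariskiFamily_hasGenericPoint hF)

/-- The structure morphism of `Z` over `D`. -/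
def zariskiToSpec {D : Subring F} {Z : Set (ValuationSubring F)} (hZ : Z ⊆ zariskiRiemann D)
    (hF : ⊤ ∈ Z) : zariskiSpace Z hF ⟶ (Spec (CommRingCat.of D)).toLocallyRingedSpace :=
  centerHom D (zariskiFamily_hasGenericPoint hF) fun V => hZ V.2

end Zariski

/-! ### Projective models -/

section Model

variable {F : Type u} [Field F]

variable (D : Subring F) {n : ℕ} (t : Fin (n + 1) → F)

/-- The ring `D_i = D[t_0 / t_i, …, t_n / t_i]`. -/
def modelRing (i : Fin (n + 1)) : Subring F :=
  Subring.closure (D ∪ Set.range fun j => t j / t i)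

/-- The projective model of `F/D` defined by `t_0, …, t_n`, as a set: all the localizations of the
rings `D_i` at their primes, where `i` runs over the indices with `t_i ≠ 0`. -/
def ProjectiveModel : Type u :=
  {R : LocalSubring F // ∃ i, t i ≠ 0 ∧
    ∃ P : PrimeSpectrum (modelRing D t i), R = LocalSubring.ofPrime (modelRing D t i) P.asIdeal}

/-- The local rings in the projective model. -/
def modelFamily : ProjectiveModel D t → LocalSubring F := Subtype.val

variable {D t}

theorem modelRing_le {i : Fin (n + 1)} {S : Subring F} (hD : D ≤ S) (h : ∀ j, t j / t i ∈ S) :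
    modelRing D t i ≤ S :=
  Subring.closure_le.2 (Set.union_subset hD (Set.range_subset_iff.2 h))

theorem le_modelRing (i : Fin (n + 1)) : D ≤ modelRing D t i :=
  fun _ h => Subring.subset_closure (Or.inl h)

theorem div_mem_modelRing (i j : Fin (n + 1)) : t j / t i ∈ modelRing D t i :=
  Subring.subset_closure (Or.inr ⟨j, rfl⟩)

theorem modelRing_le_of_inv_mem {i j : Fin (n + 1)} (hi : t i ≠ 0) {S : Subring F}
    (hS : modelRing D t i ≤ S) (h : (t j / t i)⁻¹ ∈ S) : modelRing D t j ≤ S :=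
  modelRing_le ((le_modelRing i).trans hS) fun k => by
    have h1 : t k / t j = t k / t i * (t j / t i)⁻¹ := by
      rw [inv_div, div_mul_div_cancel₀ hi]
    rw [h1]
    exact mul_mem (hS (div_mem_modelRing i k)) h

theorem modelFamily_hasGenericPoint (ht : t ≠ 0) : HasGenericPoint (modelFamily D t) := by
  obtain ⟨i, hi⟩ := Function.ne_iff.1 ht
  let K := LocalSubring.ofPrime (modelRing D t i) ⊥
  have hK : ∀ u ∈ K.toSubring, u⁻¹ ∈ K.toSubring := by
    intro u hu
    obtain ⟨a, b, hb, rfl⟩ := (mem_ofPrime _ _ _).1 hu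
    by_cases ha : a = 0
    · simp [ha]
    · exact (mem_ofPrime _ _ _).2 ⟨b, a, ha, inv_div _ _⟩
  have hiK : modelRing D t i ≤ K.toSubring := LocalSubring.le_ofPrime _ _
  refine ⟨⟨K, i, hi, ⟨⊥, Ideal.isPrime_bot⟩, rfl⟩, ?_⟩
  rintro ⟨_, j, hj, P, rfl⟩ u hu
  obtain ⟨a, b, hb, rfl⟩ := exists_eq_div P hu
  have hjK : modelRing D t j ≤ K.toSubring :=
    modelRing_le_of_inv_mem hi hiK (hK _ (hiK (div_mem_modelRing i j)))
  change (a : F) / b ∈ K.toSubring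
  rw [div_eq_mul_inv]
  exact mul_mem (hjK a.2) (hK _ (hjK b.2))

variable (D) in
/-- The projective model of `F/D` defined by `t_0, …, t_n` (not all zero) as a locally ringed space. -/
abbrev modelSpace (ht : t ≠ 0) : LocallyRingedSpace.{u} :=
  localRingSpace (modelFamily D t) (modelFamily_hasGenericPoint ht)

theorem model_le_of_dominated {R R' : ProjectiveModel D t} {S : LocalSubring F}
    (h : modelFamily D t R ≤ S) (h' : modelFamily D t R' ≤ S) :
    (modelFamily D t R).toSubring ≤ (modelFamily D t R').toSubring := by
  obtain ⟨_, i, hi, P, rfl⟩ := R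
  obtain ⟨_, j, hj, Q, rfl⟩ := R'
  refine ofPrime_toSubring_le h h' ?_
  have hjQ : modelRing D t j ≤ (LocalSubring.ofPrime (modelRing D t j) Q.asIdeal).toSubring :=
    LocalSubring.le_ofPrime _ _
  refine modelRing_le_of_inv_mem hj hjQ ?_
  refine inv_mem_of_le h' (hjQ (div_mem_modelRing j i)) (div_ne_zero hi hj) ?_
  rw [inv_div]
  exact h.1 (LocalSubring.le_ofPrime _ _ (div_mem_modelRing i j))

theorem eq_of_dominated {R R' : ProjectiveModel D t} {S : LocalSubring F}
    (h : modelFamily D t R ≤ S) (h' : modelFamily D t R' ≤ S) : R = R' :=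
  Subtype.ext (LocalSubring.toSubring_injective
    (le_antisymm (model_le_of_dominated h h') (model_le_of_dominated h' h)))

theorem exists_dominated (ht : t ≠ 0) (V : ValuationSubring F) (hV : D ≤ V.toSubring) :
    ∃ R : ProjectiveModel D t, modelFamily D t R ≤ V.toLocalSubring := by
  obtain ⟨i, hi⟩ := Finite.exists_max fun i => V.valuation (t i)
  have hi0 : t i ≠ 0 := by
    intro h0
    refine ht (funext fun j => ?_)
    have := hi j
    simpa [h0] using this
  have hle : modelRing D t i ≤ V.toLocalSubring.toSubring :=
    modelRing_le hV fun j => (V.valuation_le_one_iff _).1 (by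
      rw [map_div₀]
      exact div_le_one_of_le₀ (hi j) zero_le)
  obtain ⟨P, hP⟩ := exists_ofPrime_le hle
  exact ⟨⟨_, i, hi0, P, rfl⟩, hP⟩

variable {Z : Set (ValuationSubring F)}

/-- The unique local ring in the projective model that the valuation ring `V` dominates. -/
def dominatedPoint (ht : t ≠ 0) (hZ : Z ⊆ zariskiRiemann D) (V : Z) : ProjectiveModel D t :=
  (exists_dominated ht V.1 (hZ V.2)).choose

theorem dominatedPoint_le (ht : t ≠ 0) (hZ : Z ⊆ zariskiRiemann D) (V : Z) :
    modelFamily D t (dominatedPoint ht hZ V) ≤ V.1.toLocalSubring :=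
  (exists_dominated ht V.1 (hZ V.2)).choose_spec

theorem continuous_dominatedPoint (ht : t ≠ 0) (hZ : Z ⊆ zariskiRiemann D) :
    Continuous (X := Points (zariskiFamily Z)) (Y := Points (modelFamily D t))
      (dominatedPoint ht hZ) := by
  refine continuous_generateFrom_iff.2 ?_
  rintro _ ⟨s, rfl⟩
  rw [isOpen_iff_forall_mem_open]
  intro V hV
  have h1 : ∀ u ∈ s, ∃ O : Set (Points (zariskiFamily Z)), IsOpen O ∧ V ∈ O ∧ ∀ W ∈ O,
      u ∈ (modelFamily D t (dominatedPoint ht hZ W)).toSubring := by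
    intro u hu
    have hle := dominatedPoint_le ht hZ V
    have h2 : u ∈ (modelFamily D t (dominatedPoint ht hZ V)).toSubring := hV u hu
    generalize dominatedPoint ht hZ V = R at h2 hle
    obtain ⟨_, i, hi, P, rfl⟩ := R
    obtain ⟨a, b, hb, rfl⟩ := exists_eq_div P h2
    refine ⟨(⋂ j, {W : Points (zariskiFamily Z) | t j / t i ∈ (zariskiFamily Z W).toSubring}) ∩
      {W | (b : F)⁻¹ ∈ (zariskiFamily Z W).toSubring}, ?_, ?_, ?_⟩
    · exact (isOpen_iInter_of_finite fun j => isOpen_setOf_mem _ _).inter (isOpen_setOf_mem _ _)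
    · refine ⟨Set.mem_iInter.2 fun j => ?_, ?_⟩
      · exact hle.1 (LocalSubring.le_ofPrime _ _ (div_mem_modelRing i j))
      · exact hle.1 ((mem_ofPrime _ _ _).2 ⟨1, b, hb, by simp⟩)
    · rintro W ⟨hW1, hW2⟩
      have hDW : modelRing D t i ≤ (zariskiFamily Z W).toSubring :=
        modelRing_le (hZ W.2) (Set.mem_iInter.1 hW1)
      obtain ⟨Q, hQ⟩ := exists_ofPrime_le hDW
      have hWle := dominatedPoint_le ht hZ W
      have hEq : dominatedPoint ht hZ W = ⟨_, i, hi, Q, rfl⟩ := eq_of_dominated hWle hQ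
      have hA : modelRing D t i ≤ (modelFamily D t (dominatedPoint ht hZ W)).toSubring := by
        rw [hEq]
        exact LocalSubring.le_ofPrime _ _
      by_cases hb0 : (b : F) = 0
      · simp [hb0]
      rw [div_eq_mul_inv]
      exact mul_mem (hA a.2) (inv_mem_of_le hWle (hA b.2) hb0 hW2)
  choose! O hO hVO hOs using h1
  refine ⟨⋂ u ∈ s, O u, ?_, isOpen_biInter_finset hO, Set.mem_iInter₂.2 hVO⟩
  intro W hW u hu
  exact hOs u hu W (Set.mem_iInter₂.1 hW u hu)

/-- The domination morphism from `Z` to the projective model: it sends a valuation ring to the local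
ring in the model that it dominates, and is inclusion of subrings of `F` on sections. -/
def dominationMorphism (ht : t ≠ 0) (hZ : Z ⊆ zariskiRiemann D) (hF : ⊤ ∈ Z) :
    zariskiSpace Z hF ⟶ modelSpace D ht :=
  dominationHom _ _ ⟨dominatedPoint ht hZ, continuous_dominatedPoint ht hZ⟩
    (dominatedPoint_le ht hZ)

/-- The chart `Spec D_i → X` of the projective model `X`: it sends `P` to the localization of `D_i` at
`P`, and is inclusion of subrings of `F` on sections. -/
def modelChart (ht : t ≠ 0) (i : Fin (n + 1)) (hi : t i ≠ 0) :
    (Spec (CommRingCat.of (modelRing D t i))).toLocallyRingedSpace ⟶ modelSpace D ht :=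
  specHom (modelRing D t i) (modelFamily_hasGenericPoint ht)
    (fun P => ⟨LocalSubring.ofPrime (modelRing D t i) P.asIdeal, i, hi, P, rfl⟩) fun _ => rfl

end Model

/-! ### Projective space and morphisms defined by elements of `F` -/

section ProjectiveSpace

variable {F : Type u} [Field F]

attribute [local instance] MvPolynomial.gradedAlgebra

variable (D : Subring F) (n : ℕ)

/-- The grading of `D[T_0, …, T_n]` by degree. -/
abbrev homogeneousPolys : ℕ → Submodule D (MvPolynomial (Fin (n + 1)) D) :=
  MvPolynomial.homogeneousSubmodule (Fin (n + 1)) D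

/-- Projective `n`-space over `D`, the scheme `Proj D[T_0, …, T_n]`. -/
def projSpace : Scheme.{u} := Proj (homogeneousPolys D n)

/-- The structure morphism of projective space over `D`. -/
def projSpaceToSpec : projSpace D n ⟶ Spec (CommRingCat.of D) :=
  Proj.toSpecZero (homogeneousPolys D n) ≫
    Spec.map (CommRingCat.ofHom (algebraMap D (homogeneousPolys D n 0)))

/-- The standard affine chart `Spec D[T_0 / T_i, …, T_n / T_i] → ℙ^n_D`, whose ring is the degree zero
part of `D[T_0, …, T_n]` localized at `T_i`. -/
def stdChart (i : Fin (n + 1)) :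
    Spec (CommRingCat.of (HomogeneousLocalization.Away (homogeneousPolys D n)
      (MvPolynomial.X i))) ⟶ projSpace D n :=
  Proj.awayι (homogeneousPolys D n) (MvPolynomial.X i)
    ((MvPolynomial.mem_homogeneousSubmodule 1 _).2 (MvPolynomial.isHomogeneous_X D i)) Nat.one_pos

variable {D n}

/-- The `D`-algebra homomorphism `b_i : D[T_0 / T_i, …, T_n / T_i] → D_i` with
`T_j / T_i ↦ t_j / t_i`. -/
def coordHom (t : Fin (n + 1) → F) (i : Fin (n + 1)) (hi : t i ≠ 0) :
    HomogeneousLocalization.Away (homogeneousPolys D n) (MvPolynomial.X i) →+*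
      modelRing D t i :=
  (IsLocalization.Away.lift
    (S := Localization.Away (MvPolynomial.X i : MvPolynomial (Fin (n + 1)) D))
    (MvPolynomial.X i : MvPolynomial (Fin (n + 1)) D)
    (g := MvPolynomial.eval₂Hom (Subring.inclusion (le_modelRing i)) fun j =>
      ⟨t j / t i, div_mem_modelRing i j⟩) (by
        have : (⟨t i / t i, div_mem_modelRing i i⟩ : modelRing D t i) = 1 :=
          Subtype.ext (div_self hi)
        simp [this])).comp
    (algebraMap (HomogeneousLocalization.Away (homogeneousPolys D n) (MvPolynomial.X i))
      (Localization.Away (MvPolynomial.X i)))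

/-- The morphism `Spec D_i → Spec D[T_0 / T_i, …, T_n / T_i] → ℙ^n_D` induced by `b_i`. -/
def coordMorphism (t : Fin (n + 1) → F) (i : Fin (n + 1)) (hi : t i ≠ 0) :
    Spec (CommRingCat.of (modelRing D t i)) ⟶ projSpace D n :=
  Spec.map (CommRingCat.ofHom (coordHom t i hi)) ≫ stdChart D n i

/-- The morphism `γ` from the projective model to `ℙ^n_D` is the one that is glued from the morphisms
`Spec D_i → Spec D[T_0 / T_i, …, T_n / T_i] → ℙ^n_D`, where `t_i ≠ 0`. There is exactly one such `γ`,
since the charts `Spec D_i` cover the model. -/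
def IsGluedFromCharts {t : Fin (n + 1) → F} (ht : t ≠ 0)
    (γ : modelSpace D ht ⟶ (projSpace D n).toLocallyRingedSpace) : Prop :=
  ∀ (i : Fin (n + 1)) (hi : t i ≠ 0),
    modelChart ht i hi ≫ γ = (coordMorphism t i hi).toLRSHom

/-- The morphism `φ` is the morphism defined by `t_0, …, t_n` (not all zero): it is the domination
morphism to the projective model defined by `t_0, …, t_n`, followed by the closed immersion of the
model into `ℙ^n_D`. -/
def IsMorphismDefinedBy {Z : Set (ValuationSubring F)} (hZ : Z ⊆ zariskiRiemann D) (hF : ⊤ ∈ Z)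
    (t : Fin (n + 1) → F) (φ : zariskiSpace Z hF ⟶ (projSpace D n).toLocallyRingedSpace) : Prop :=
  ∃ (ht : t ≠ 0) (γ : modelSpace D ht ⟶ (projSpace D n).toLocallyRingedSpace),
    IsGluedFromCharts ht γ ∧ φ = dominationMorphism ht hZ hF ≫ γ

end ProjectiveSpace

end

/-!
A morphism `f` from the space of a family `r` of local subrings of `F` to a scheme `Y` amounts to the
morphisms `Spec (r x) → Y` given by its stalk maps (`pointMorphism`), and these all restrict to one
and the same morphism `Spec F → Y` (`genericMorphism`), because a section is a single element of `F`.
If `Y` is separated, then `f` is determined by this generic morphism (`ext_genericMorphism`): the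
morphism `Spec F → Spec (r x)` is dominant and `Spec (r x)` is reduced. This is the uniqueness half of
the valuative criterion. Conversely, morphisms `Spec (r x) → Y` with a common restriction to `Spec F`
come from a morphism of the whole space as soon as the images of the closed points vary continuously
(`ofPointMorphisms`).

Projective space is separated, so the theorem reduces to `Spec F`. The generic morphism of `φ` lands
in a standard chart, hence is a ring homomorphism `D[T_0 / T_i, …, T_n / T_i] → F`, and it fixes `D`
since `φ` is a `D`-morphism. With `t_j` the image of `T_j / T_i`, it is evaluation at `t`
(`exists_homogeneous_coordinates`). On the side of the model, the morphisms `Spec D_i → ℙ^n_D` all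
restrict to evaluation at `t` on `Spec F` (`specField_comp_coordMorphism_eq`), by comparison on the
charts `T_i T_j ≠ 0`. By separatedness they agree on the local rings of the model, which yields `γ`
(`exists_isGluedFromCharts`), and the generic morphism of `γ`, hence that of `δ ≫ γ`, is evaluation
at `t` as well.
-/

noncomputable section

open TopologicalSpace Opposite
open LocalRingSpace

/-! ### Morphisms from spaces of local subrings to schemes -/

namespace LocalRingSpace

section

variable {F : Type u} [Field F] {ι κ : Type u} {r : ι → LocalSubring F} {hr : HasGenericPoint r}
  {q : κ → LocalSubring F} {hq : HasGenericPoint q}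

/-- The local homomorphism `𝒪_{Y, f x} → r x` induced by `f`. -/
def valueHom {Y : LocallyRingedSpace.{u}} (f : localRingSpace r hr ⟶ Y) (x : Points r) :
    Y.presheaf.stalk (f.base x) ⟶ CommRingCat.of (r x).toSubring :=
  f.stalkMap x ≫ stalkEval r x

instance {Y : LocallyRingedSpace.{u}} (f : localRingSpace r hr ⟶ Y) (x : Points r) :
    IsLocalHom (valueHom f x).hom := by
  have h1 : IsLocalHom (f.stalkMap x).hom := f.prop x
  have h2 : IsLocalHom (stalkEval r x).hom := ⟨fun a ha =>
    (isUnit_map_iff (stalkEquiv r x) a).1 ha⟩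
  exact @RingHom.isLocalHom_comp _ _ _ _ _ _ (stalkEval r x).hom (f.stalkMap x).hom h2 h1

theorem stalkEval_stalkMap_germ {Y : LocallyRingedSpace.{u}}
    (f : (localRingSpace r hr).toPresheafedSpace ⟶ Y.toPresheafedSpace) (x : Points r)
    (U : Opens Y) (hx : f.base x ∈ U) (s : Y.presheaf.obj (op U)) :
    (((stalkEval r x).hom ((f.stalkMap x).hom (Y.presheaf.germ U (f.base x) hx s)) :
      (r x).toSubring) : F) = ((f.c.app (op U)).hom s : sections r _).1 ⟨x, hx⟩ :=
  (congrArg (fun a => ((stalkEval r x).hom a : F))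
    (PresheafedSpace.stalkMap_germ_apply f U x hx s)).trans (stalkEval_germ r _ x hx _)

theorem valueHom_germ {Y : LocallyRingedSpace.{u}} (f : localRingSpace r hr ⟶ Y) (x : Points r)
    (U : Opens Y) (hx : f.base x ∈ U) (s : Y.presheaf.obj (op U)) :
    ((valueHom f x (Y.presheaf.germ U (f.base x) hx s) : (r x).toSubring) : F) =
      ((f.c.app (op U)).hom s : sections r _).1 ⟨x, hx⟩ :=
  stalkEval_stalkMap_germ f.toHom x U hx s

/-- To check that the stalk map at `x` is local it suffices to have a local homomorphism to `r x` that
computes the values at `x` of sections. -/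
theorem isLocalHom_stalkMap {Y : LocallyRingedSpace.{u}}
    (f : (localRingSpace r hr).toPresheafedSpace ⟶ Y.toPresheafedSpace) (x : Points r)
    (ψ : Y.presheaf.stalk (f.base x) ⟶ CommRingCat.of (r x).toSubring) (hψ : IsLocalHom ψ.hom)
    (h : ∀ (U : Opens Y) (hx : f.base x ∈ U) (s : Y.presheaf.obj (op U)),
      ((ψ (Y.presheaf.germ U (f.base x) hx s) : (r x).toSubring) : F) =
        ((f.c.app (op U)).hom s : sections r _).1 ⟨x, hx⟩) :
    IsLocalHom (f.stalkMap x).hom := by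
  constructor
  intro a ha
  obtain ⟨U, hxU, s, rfl⟩ := Y.presheaf.exists_germ_eq a
  have h1 : IsUnit (_ : (r x).toSubring) := ha.map (stalkEval r x).hom
  have h2 : (_ : (r x).toSubring) = ψ _ := Subtype.ext
    ((stalkEval_stalkMap_germ (hr := hr) f x U hxU s).trans (h U hxU s).symm)
  exact hψ.map_nonunit _ (Eq.subst (motive := fun a : (r x).toSubring => IsUnit a) h2 h1)

variable {Y : Scheme.{u}}

/-- The morphism `Spec (r x) → Y` induced by `f`, which sends the closed point to `f x`. -/
def pointMorphism (f : localRingSpace r hr ⟶ Y.toLocallyRingedSpace) (x : Points r) :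
    Spec (CommRingCat.of (r x).toSubring) ⟶ Y :=
  Spec.map (valueHom f x) ≫ Y.fromSpecStalk (f.base x)

/-- The morphism `Spec F → Spec A` induced by the inclusion of a subring `A` of `F`. -/
def specField (A : Subring F) : Spec (CommRingCat.of F) ⟶ Spec (CommRingCat.of A) :=
  Spec.map (CommRingCat.ofHom A.subtype)

instance (A : Subring F) : IsDominant (specField A) := by
  refine ⟨(PrimeSpectrum.denseRange_comap_iff_ker_le_nilRadical A.subtype).2 ?_⟩
  rw [(RingHom.injective_iff_ker_eq_bot _).1 A.subtype_injective]
  exact bot_le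

/-- A morphism from `Spec A` to a separated scheme is determined by its restriction to `Spec F`. -/
theorem eq_of_specField_comp_eq [Y.IsSeparated] {A : Subring F} {f g : Spec (CommRingCat.of A) ⟶ Y}
    (h : specField A ≫ f = specField A ≫ g) : f = g :=
  ext_of_isDominant (specField A) h

/-- A morphism to a scheme is determined by the morphisms from the spectra of the local rings `r x`,
because a morphism from the spectrum of a local ring is the same as a point of the scheme together
with a local homomorphism out of its stalk. -/
theorem ext_pointMorphism {f g : localRingSpace r hr ⟶ Y.toLocallyRingedSpace}
    (h : ∀ x, pointMorphism f x = pointMorphism g x) : f = g := by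
  have key : ∀ x : Points r, ∃ hx : f.base x = g.base x, valueHom f x =
      (Y.presheaf.stalkCongr (.of_eq hx)).hom ≫ valueHom g x := fun x =>
    SpecToEquivOfLocalRing_eq_iff.1 ((SpecToEquivOfLocalRing Y
      (CommRingCat.of (r x).toSubring)).symm.injective
      (a₁ := ⟨f.base x, valueHom f x, inferInstance⟩) (a₂ := ⟨g.base x, valueHom g x, inferInstance⟩) (h x))
  obtain ⟨⟨fb, fc⟩, fp⟩ := f
  obtain ⟨⟨gb, gc⟩, gp⟩ := g
  obtain rfl : fb = gb := by
    ext x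
    exact (key x).1
  obtain rfl : fc = gc := by
    refine NatTrans.ext (funext fun U => ?_)
    ext s
    refine Subtype.ext (funext fun x => ?_)
    obtain ⟨_, hx⟩ := key x.1
    rw [TopCat.Presheaf.stalkCongr_hom, TopCat.Presheaf.stalkSpecializes_refl,
      Category.id_comp] at hx
    exact (valueHom_germ ⟨⟨fb, fc⟩, fp⟩ x.1 U.unop x.2 s).symm.trans
      ((congrArg (fun a => ((a (Y.presheaf.germ U.unop _ x.2 s) : (r x.1).toSubring) : F)) hx).trans
        (valueHom_germ ⟨⟨fb, gc⟩, gp⟩ x.1 U.unop x.2 s))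
  rfl

/-- The morphism `Spec F → Y` obtained by restricting `f` to the local ring at any point. -/
def genericMorphism (f : localRingSpace r hr ⟶ Y.toLocallyRingedSpace) (x : Points r) :
    Spec (CommRingCat.of F) ⟶ Y :=
  specField _ ≫ pointMorphism f x

/-- Sections are constant functions, so the restriction of `f` to `Spec F` is the same at all points. -/
theorem genericMorphism_eq (f : localRingSpace r hr ⟶ Y.toLocallyRingedSpace) (x y : Points r) :
    genericMorphism f x = genericMorphism f y := by
  obtain ⟨η, hη⟩ := id hr
  suffices ∀ x, genericMorphism f η = genericMorphism f x from (this x).symm.trans (this y)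
  intro x
  have hs : f.base η ⤳ f.base x := by
    refine Specializes.map (X := Points r) (x := η) (y := x) ?_ f.base.hom.continuous
    exact specializes_iff_forall_open.2 fun U hU hx => generic_mem_of_isOpen hη hU hx
  have : valueHom f x ≫ CommRingCat.ofHom (r x).toSubring.subtype =
      Y.presheaf.stalkSpecializes hs ≫ valueHom f η ≫
        CommRingCat.ofHom (r η).toSubring.subtype := by
    refine TopCat.Presheaf.stalk_hom_ext _ fun U hxU => ?_
    rw [TopCat.Presheaf.germ_stalkSpecializes_assoc]
    ext s
    refine (valueHom_germ f x U hxU s).trans (Eq.trans ?_ (valueHom_germ f η U _ s).symm)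
    exact Subtype.property ((f.c.app (op U)).hom s : sections r _) |>.2 _ _
  change Spec.map _ ≫ Spec.map _ ≫ _ = Spec.map _ ≫ Spec.map _ ≫ _
  rw [← Spec.map_comp_assoc, ← Spec.map_comp_assoc, this,
    ← Scheme.SpecMap_stalkSpecializes_fromSpecStalk hs, ← Spec.map_comp_assoc]

/-- A morphism to a separated scheme is determined by its generic morphism. -/
theorem ext_genericMorphism [Y.IsSeparated] {f g : localRingSpace r hr ⟶ Y.toLocallyRingedSpace}
    (x : Points r) (h : genericMorphism f x = genericMorphism g x) : f = g :=
  ext_pointMorphism fun y => eq_of_specField_comp_eq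
    ((genericMorphism_eq f y x).trans (h.trans (genericMorphism_eq g x y)))

/-- The value at the closed point of the pullback of `s` to `Spec A`, as an element of `F`, can be
computed on `Spec F`. -/
theorem stalkClosedPointTo_germ {A : Subring F} [IsLocalRing A] (g : Spec (CommRingCat.of A) ⟶ Y)
    (U : Y.Opens) (hU : g (IsLocalRing.closedPoint A) ∈ U)
    (hU' : (specField A ≫ g) (IsLocalRing.closedPoint F) ∈ U) (s : Γ(Y, U)) :
    ((Scheme.stalkClosedPointTo g (Y.presheaf.germ U _ hU s) : A) : F) =
      Scheme.stalkClosedPointTo (R := CommRingCat.of F) (specField A ≫ g)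
        (Y.presheaf.germ U _ hU' s) := by
  have h : Y.presheaf.germ U _ hU ≫ Scheme.stalkClosedPointTo g ≫ CommRingCat.ofHom A.subtype =
      Y.presheaf.germ U _ hU' ≫
        Scheme.stalkClosedPointTo (R := CommRingCat.of F) (specField A ≫ g) := by
    rw [Scheme.germ_stalkClosedPointTo_assoc, Scheme.germ_stalkClosedPointTo,
      Scheme.Hom.comp_app]
    simp only [Iso.trans_hom, Category.assoc]
    rw [← Scheme.ΓSpecIso_naturality]
    simp [specField, Scheme.Hom.app_eq_appLE]
    rw [Scheme.Hom.appLE_comp_appLE]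
    exact Scheme.Hom.appLE_comp_appLE ..
  exact congrArg (fun a => a s) (congrArg (fun a => a.hom) h)

/-- A family of morphisms `g x : Spec (r x) → Y` glues to a morphism from the space attached to
`r` if all `g x` have the same restriction `G` to `Spec F`, and the images of the closed points depend
continuously on `x`. -/
def ofPointMorphisms (G : Spec (CommRingCat.of F) ⟶ Y)
    (g : ∀ x : Points r, Spec (CommRingCat.of (r x).toSubring) ⟶ Y)
    (hG : ∀ x, specField _ ≫ g x = G)
    (hc : Continuous fun x : Points r => g x (IsLocalRing.closedPoint (r x).toSubring)) :
    localRingSpace r hr ⟶ Y.toLocallyRingedSpace :=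
  have hη : ∀ (U : Y.Opens) (x : Points r), g x (IsLocalRing.closedPoint (r x).toSubring) ∈ U →
      G (IsLocalRing.closedPoint F) ∈ U := fun U x hx => by
    rw [← hG x]
    -- The image of `Spec F` specializes to the closed point of `Spec (r x)`.
    exact ((IsLocalRing.specializes_closedPoint
      ((specField (r x).toSubring) (IsLocalRing.closedPoint F))).map (g x).continuous).mem_open U.2 hx
  have hval : ∀ (U : Y.Opens) (x : Points r)
      (hx : g x (IsLocalRing.closedPoint (r x).toSubring) ∈ U) (s : Γ(Y, U)),
      ((Scheme.stalkClosedPointTo (g x) (Y.presheaf.germ U _ hx s) : (r x).toSubring) : F) =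
        Scheme.stalkClosedPointTo (R := CommRingCat.of F) G (Y.presheaf.germ U _ (hη U x hx) s) := by
    intro U x hx s
    obtain rfl := hG x
    exact stalkClosedPointTo_germ (g x) U hx _ s
  { base := TopCat.ofHom ⟨_, hc⟩
    c :=
      { app U := CommRingCat.ofHom (S := sections r _)
          { toFun s := ⟨fun x => (Scheme.stalkClosedPointTo (g x.1) (Y.presheaf.germ U.unop _ x.2 s) :
                (r x.1).toSubring), fun x => Subtype.property _, fun x y =>
                (hval U.unop x.1 x.2 s).trans (hval U.unop y.1 y.2 s).symm⟩
            map_zero' := Subtype.ext <| funext fun x => congrArg Subtype.val (map_zero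
              ((Scheme.stalkClosedPointTo (g x.1)).hom.comp (Y.presheaf.germ U.unop _ x.2).hom))
            map_add' s t := Subtype.ext <| funext fun x => congrArg Subtype.val (map_add
              ((Scheme.stalkClosedPointTo (g x.1)).hom.comp (Y.presheaf.germ U.unop _ x.2).hom) s t)
            map_one' := Subtype.ext <| funext fun x => congrArg Subtype.val (map_one
              ((Scheme.stalkClosedPointTo (g x.1)).hom.comp (Y.presheaf.germ U.unop _ x.2).hom))
            map_mul' s t := Subtype.ext <| funext fun x => congrArg Subtype.val (map_mul
              ((Scheme.stalkClosedPointTo (g x.1)).hom.comp (Y.presheaf.germ U.unop _ x.2).hom) s t) }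
        naturality U V i := by
          ext s
          refine Subtype.ext (funext fun x => ?_)
          exact congrArg (fun a => ((Scheme.stalkClosedPointTo (g x.1) a : (r x.1).toSubring) : F))
            (TopCat.Presheaf.germ_res_apply Y.presheaf i.unop _ x.2 s) }
    prop x := isLocalHom_stalkMap (hr := hr) _ x (Scheme.stalkClosedPointTo (g x))
      (Scheme.isLocalHom_stalkClosedPointTo (g x)) fun _ _ _ => rfl }

theorem pointMorphism_ofPointMorphisms (G : Spec (CommRingCat.of F) ⟶ Y)
    (g : ∀ x : Points r, Spec (CommRingCat.of (r x).toSubring) ⟶ Y)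
    (hG : ∀ x, specField _ ≫ g x = G)
    (hc : Continuous fun x : Points r => g x (IsLocalRing.closedPoint (r x).toSubring))
    (x : Points r) :
    pointMorphism (hr := hr) (ofPointMorphisms G g hG hc) x = g x := by
  refine Eq.trans ?_ (Scheme.Spec_stalkClosedPointTo_fromSpecStalk (g x))
  change Spec.map _ ≫ _ = _
  congr 2
  refine TopCat.Presheaf.stalk_hom_ext _ fun U hxU => ?_
  ext s
  exact valueHom_germ (ofPointMorphisms G g hG hc) x U hxU s

/-! ### Generic morphisms of composites -/

/-- The morphism `Spec F → Y` given by a homomorphism `θ` out of a stalk is the generic morphism of `f`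
if `θ` sends each germ to the element of `F` that is its pullback along `f`. -/
theorem genericMorphism_eq_map (f : localRingSpace r hr ⟶ Y.toLocallyRingedSpace) (x : Points r)
    {y : Y} (hy : f.base x = y) (θ : Y.presheaf.stalk y ⟶ CommRingCat.of F)
    (hθ : ∀ (U : Y.Opens) (hx : f.base x ∈ U) (s : Γ(Y, U)),
      ((f.c.app (op U)).hom s : sections r _).1 ⟨x, hx⟩ = θ (Y.presheaf.germ U y (hy ▸ hx) s)) :
    genericMorphism f x = Spec.map θ ≫ Y.fromSpecStalk y := by
  subst hy
  refine (Spec.map_comp_assoc _ _ _).symm.trans ?_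
  congr 2
  refine TopCat.Presheaf.stalk_hom_ext _ fun U hxU => ?_
  ext s
  exact (valueHom_germ f x U hxU s).trans (hθ U hxU s)

theorem genericMorphism_dominationHom_comp (d : C(Points r, Points q)) (hd : ∀ x, q (d x) ≤ r x)
    (γ : localRingSpace q hq ⟶ Y.toLocallyRingedSpace) (x : Points r) :
    genericMorphism (dominationHom hr hq d hd ≫ γ) x = genericMorphism γ (d x) :=
  (genericMorphism_eq_map _ x (y := γ.base (d x)) rfl
    (valueHom γ (d x) ≫ CommRingCat.ofHom (q (d x)).toSubring.subtype) fun U hx s =>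
      (valueHom_germ γ (d x) U hx s).symm).trans (Spec.map_comp_assoc _ _ _)

/-- The homomorphism `𝒪_{Y, f x} → r x ⊆ F` induced by `f`, with the point `f x` as a variable of type
`Y`. -/
theorem exists_eq_stalk_hom (f : localRingSpace r hr ⟶ Y.toLocallyRingedSpace) (x : Points r) :
    ∃ (y : Y) (hy : f.base x = y) (θ : Y.presheaf.stalk y ⟶ CommRingCat.of F),
      ∀ (U : Y.Opens) (hx : f.base x ∈ U) (s : Γ(Y, U)),
      ((f.c.app (op U)).hom s : sections r _).1 ⟨x, hx⟩ = θ (Y.presheaf.germ U y (hy ▸ hx) s) :=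
  ⟨f.base x, rfl, valueHom f x ≫ CommRingCat.ofHom (r x).toSubring.subtype, fun U hx s =>
    (valueHom_germ f x U hx s).symm⟩

theorem genericMorphism_comp {Y' : Scheme.{u}} (f : localRingSpace r hr ⟶ Y.toLocallyRingedSpace)
    (p : Y ⟶ Y') (x : Points r) :
    genericMorphism (f ≫ p.toLRSHom) x = genericMorphism f x ≫ p := by
  obtain ⟨y, hy, θ, hθ⟩ := exists_eq_stalk_hom f x
  rw [genericMorphism_eq_map f x hy θ hθ, Category.assoc,
    ← Scheme.SpecMap_stalkMap_fromSpecStalk, ← Spec.map_comp_assoc]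
  refine genericMorphism_eq_map _ x (congrArg p hy) _ fun U hx s => ?_
  refine (hθ (p ⁻¹ᵁ U) hx (p.app U s)).trans ?_
  exact congrArg θ (Scheme.Hom.germ_stalkMap_apply p U y _ s).symm

theorem map_comp_fromSpecStalk_eq_specField {A : Subring F} (P : Spec (CommRingCat.of A))
    (θ : (Spec (CommRingCat.of A)).presheaf.stalk P ⟶ CommRingCat.of F)
    (hθ : ∀ a : A, θ ((Spec (CommRingCat.of A)).presheaf.germ ⊤ P trivial
      ((Scheme.ΓSpecIso (CommRingCat.of A)).inv a)) = (a : F)) :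
    Spec.map θ ≫ (Spec (CommRingCat.of A)).fromSpecStalk P = specField A := by
  rw [Spec.fromSpecStalk_eq, ← Spec.map_comp, specField]
  congr 1
  ext a
  exact hθ a

theorem genericMorphism_centerHom (A : Subring F) (hA : ∀ x, A ≤ (r x).toSubring) (x : Points r) :
    genericMorphism (Y := Spec (CommRingCat.of A)) (centerHom A hr hA) x = specField A := by
  obtain ⟨y, hy, θ, hθ⟩ :=
    exists_eq_stalk_hom (Y := Spec (CommRingCat.of A)) (centerHom A hr hA) x
  rw [genericMorphism_eq_map (Y := Spec (CommRingCat.of A)) (centerHom A hr hA) x hy θ hθ,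
    map_comp_fromSpecStalk_eq_specField y θ]
  intro a
  refine (hθ ⊤ trivial _).symm.trans ?_
  -- `centerHom` is adjoint to the inclusion of `A` into the ring of global sections.
  have h := ΓSpec.toOpen_comp_locallyRingedSpaceAdjunction_homEquiv_app
    (X := localRingSpace r hr) (R := A) (Quiver.Hom.op
      (CommRingCat.ofHom (R := A) (S := sections r ⊤)
      { toFun a := ⟨fun _ => a, fun x => hA x.1 a.2, fun _ _ => rfl⟩
        map_one' := rfl
        map_mul' _ _ := rfl
        map_zero' := rfl
        map_add' _ _ := rfl })) (op ⊤)
  exact congrArg (fun f : CommRingCat.of A ⟶ CommRingCat.of (sections r _) =>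
    (f a : sections r ⊤).1 ⟨x, trivial⟩) h

/-- The stalk of `Spec A` at `P` is the localization of `A` at `P`, so it maps to `F` over `A`. -/
theorem exists_stalk_hom {A : Subring F} (P : PrimeSpectrum A) :
    ∃ E : (Spec.structureSheaf (CommRingCat.of A)).presheaf.stalk P →+* F,
      ∀ a : A, E (StructureSheaf.toStalk A P a) = a :=
  ⟨IsLocalization.lift (S := (Spec.structureSheaf A).presheaf.stalk P) (M := P.asIdeal.primeCompl)
      (g := A.subtype) fun b => IsUnit.mk0 _ fun h0 => b.2 (by
        have h1 : b.1 = 0 := Subtype.ext h0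
        rw [h1]; exact P.asIdeal.zero_mem),
    fun a => IsLocalization.lift_eq (S := (Spec.structureSheaf A).presheaf.stalk P) _ a⟩

/-- If a section is the element `a / b` of `F`, then `b` times the corresponding section of `Spec A` is
`a` on the whole open set, also at the points where `b` vanishes. -/
theorem algebraMap_mul_specApp {A : Subring F} (d : PrimeSpectrum.Top A ⟶ top r)
    (hd : ∀ P : PrimeSpectrum A, r (d P) = LocalSubring.ofPrime A P.asIdeal) (U : Opens (top r))
    (s : sections r U) (x : U) (a b : A) (h : s.1 x * b = a) :
    algebraMap A _ b * specApp d hd U s = algebraMap A _ a := by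
  refine Subtype.ext (funext fun Q => ?_)
  change algebraMap A _ b * localizationEquiv A Q.1 _ = algebraMap A _ a
  rw [← (localizationEquiv A Q.1).commutes a, ← (localizationEquiv A Q.1).commutes b, ← map_mul]
  refine congrArg _ (Subtype.ext ?_)
  refine (mul_comm _ _).trans (Eq.trans ?_ h)
  exact congrArg (· * (b : F)) (s.2.2 _ _)

theorem stalk_hom_germ_specApp {A : Subring F} (d : PrimeSpectrum.Top A ⟶ top r)
    (hd : ∀ P : PrimeSpectrum A, r (d P) = LocalSubring.ofPrime A P.asIdeal) (P : PrimeSpectrum A)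
    (E : (Spec.structureSheaf (CommRingCat.of A)).presheaf.stalk P →+* F)
    (hE : ∀ a : A, E (StructureSheaf.toStalk A P a) = a) (U : Opens (top r)) (hP : d P ∈ U)
    (s : sections r U) :
    E ((Spec.structureSheaf (CommRingCat.of A)).presheaf.germ ((Opens.map d).obj U) P hP
      (specAppHom d hd U s)) = s.1 ⟨d P, hP⟩ := by
  obtain ⟨a, b, hb, h⟩ := exists_eq_div (u := s.1 ⟨d P, hP⟩) P (by
    rw [← hd P]
    exact s.2.1 ⟨d P, hP⟩)
  have hb0 : (b : F) ≠ 0 := fun h0 => hb (by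
    have h1 : b = 0 := Subtype.ext h0
    rw [h1]; exact P.asIdeal.zero_mem)
  have h1 := algebraMap_mul_specApp d hd U s ⟨d P, hP⟩ a b ((eq_div_iff hb0).1 h)
  have h2 := congrArg (fun σ => E ((structurePresheafInCommRingCat A).germ
    ((Opens.map d).obj U) P hP σ)) h1
  have h3 : ∀ c : A, E ((structurePresheafInCommRingCat A).germ ((Opens.map d).obj U) P hP
      (algebraMap A ((structureSheafInType A A).obj.obj (op ((Opens.map d).obj U))) c)) = c :=
    fun c => (congrArg E (StructureSheaf.algebraMap_germ_apply _ P hP c)).trans (hE c)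
  rw [h, eq_div_iff hb0, ← h3 a, ← h3 b, ← h2, mul_comm]
  exact ((E.comp ((structurePresheafInCommRingCat A).germ
    ((Opens.map d).obj U) P hP).hom).map_mul _ _).symm

/-- The composite of `specHom` with a morphism `γ` to a scheme restricts on `Spec F` to the generic
morphism of `γ`. The composite is a scheme morphism `h`, as source and target are schemes. -/
theorem specField_comp_specHom (A : Subring F) (d : PrimeSpectrum A → Points r)
    (hd : ∀ P, r (d P) = LocalSubring.ofPrime A P.asIdeal)
    (γ : localRingSpace r hr ⟶ Y.toLocallyRingedSpace) (P : PrimeSpectrum A)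
    (h : Spec (CommRingCat.of A) ⟶ Y) (hh : h.toLRSHom = specHom A hr d hd ≫ γ) :
    specField A ≫ h = genericMorphism γ (d P) := by
  obtain ⟨P, rfl⟩ : ∃ Q : Spec (CommRingCat.of A), (show PrimeSpectrum A from Q) = P := ⟨P, rfl⟩
  obtain ⟨E, hE⟩ := exists_stalk_hom (A := A) P
  let θ : (Spec (CommRingCat.of A)).presheaf.stalk P ⟶ CommRingCat.of F := CommRingCat.ofHom E
  rw [← map_comp_fromSpecStalk_eq_specField P θ hE, Category.assoc,
    ← Scheme.SpecMap_stalkMap_fromSpecStalk, ← Spec.map_comp_assoc]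
  have hb : ∀ Q : Spec (CommRingCat.of A), h Q = γ.base (d Q) := fun Q =>
    congrArg (fun f : (Spec (CommRingCat.of A)).toLocallyRingedSpace ⟶ Y.toLocallyRingedSpace =>
      f.base Q) hh
  refine (genericMorphism_eq_map γ (d P) (hb P).symm _ fun U hx s => ?_).symm
  refine Eq.trans ?_ (congrArg E (Scheme.Hom.germ_stalkMap_apply h U P _ s).symm)
  obtain ⟨h⟩ := h
  obtain rfl : h = _ := hh
  exact (stalk_hom_germ_specApp (TopCat.ofHom ⟨d, continuous_of_eq_ofPrime d hd⟩) hd P E hE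
    ((Opens.map γ.base).obj U) hx ((γ.c.app (op U)).hom s)).symm

end
end LocalRingSpace
/-! ### Evaluation of quotients of homogeneous polynomials -/

theorem MvPolynomial.IsHomogeneous.eval₂_mul {σ R S : Type*} [Fintype σ] [CommSemiring R]
    [CommSemiring S] {a : MvPolynomial σ R} {m : ℕ} (ha : a.IsHomogeneous m) (f : R →+* S) (c : S) (x : σ → S) :
    a.eval₂ f (fun j => c * x j) = c ^ m * a.eval₂ f x := by
  rw [MvPolynomial.eval₂_eq', MvPolynomial.eval₂_eq', Finset.mul_sum]
  refine Finset.sum_congr rfl fun d hd => ?_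
  have h : ∑ i, d i = m := by
    rw [← Finsupp.degree_eq_sum]
    by_contra h
    exact MvPolynomial.mem_support_iff.1 hd (ha.coeff_eq_zero h)
  simp_rw [mul_pow]
  rw [Finset.prod_mul_distrib, Finset.prod_pow_eq_pow_sum, h]
  ring

section ProjectiveSpace

variable {F : Type u} [Field F]

attribute [local instance] MvPolynomial.gradedAlgebra

variable {D : Subring F} {n : ℕ}

open HomogeneousLocalization

theorem X_mem_homogeneousPolys (i : Fin (n + 1)) : MvPolynomial.X i ∈ homogeneousPolys D n 1 :=
  (MvPolynomial.mem_homogeneousSubmodule 1 _).2 (MvPolynomial.isHomogeneous_X D i)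

theorem lift_val_awayMk_mul {S : Type*} [CommRing S] {f : MvPolynomial (Fin (n + 1)) D} {d : ℕ}
    (hf : f ∈ homogeneousPolys D n d) (g : MvPolynomial (Fin (n + 1)) D →+* S) (hg : IsUnit (g f))
    (m : ℕ) (a : MvPolynomial (Fin (n + 1)) D) (ha : a ∈ homogeneousPolys D n (m • d)) :
    IsLocalization.Away.lift (S := Localization.Away f) f hg
      (Away.mk (homogeneousPolys D n) hf m a ha).val * g f ^ m = g a := by
  rw [Away.val_mk, Localization.mk_eq_mk',
    ← map_pow, ← IsLocalization.Away.lift_eq (S := Localization.Away f) f hg (f ^ m), ← map_mul]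
  rw [IsLocalization.mk'_spec _ a (⟨f ^ m, m, rfl⟩ : Submonoid.powers f),
    IsLocalization.Away.lift_eq]

/-- Evaluation at `t`, on quotients of homogeneous polynomials whose denominator is a power of a
polynomial `f` that does not vanish at `t`. -/
def evalAway (t : Fin (n + 1) → F) (f : MvPolynomial (Fin (n + 1)) D)
    (hf : f.eval₂ D.subtype t ≠ 0) : Away (homogeneousPolys D n) f →+* F :=
  (IsLocalization.Away.lift (S := Localization.Away f) f
    (g := MvPolynomial.eval₂Hom D.subtype t) (IsUnit.mk0 _ hf)).comp
      (algebraMap (Away (homogeneousPolys D n) f) (Localization.Away f))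

theorem evalAway_mk (t : Fin (n + 1) → F) {f : MvPolynomial (Fin (n + 1)) D} {d : ℕ}
    (hf : f ∈ homogeneousPolys D n d) (h0 : f.eval₂ D.subtype t ≠ 0) (m : ℕ)
    (a : MvPolynomial (Fin (n + 1)) D) (ha : a ∈ homogeneousPolys D n (m • d)) :
    evalAway t f h0 (Away.mk _ hf m a ha) = a.eval₂ D.subtype t / f.eval₂ D.subtype t ^ m :=
  (eq_div_iff (pow_ne_zero m h0)).2 (lift_val_awayMk_mul hf
    (MvPolynomial.eval₂Hom D.subtype t) (IsUnit.mk0 _ h0) m a ha)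

theorem evalAway_comp_awayMap (t : Fin (n + 1) → F) {f g x : MvPolynomial (Fin (n + 1)) D} {d e : ℕ}
    (hf : f ∈ homogeneousPolys D n d) (hg : g ∈ homogeneousPolys D n e) (hx : x = f * g)
    (hf0 : f.eval₂ D.subtype t ≠ 0) (hx0 : x.eval₂ D.subtype t ≠ 0) :
    (evalAway t x hx0).comp (awayMap (homogeneousPolys D n) hg hx) = evalAway t f hf0 := by
  refine RingHom.ext fun z => ?_
  obtain ⟨m, a, ha, rfl⟩ := Away.mk_surjective (homogeneousPolys D n) hf z
  have hg0 : g.eval₂ D.subtype t ≠ 0 := by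
    rintro h
    rw [hx, MvPolynomial.eval₂_mul, h, mul_zero] at hx0
    exact hx0 rfl
  rw [RingHom.comp_apply, awayMap_mk, evalAway_mk, evalAway_mk, MvPolynomial.eval₂_mul,
    MvPolynomial.eval₂_pow, hx, MvPolynomial.eval₂_mul, mul_pow,
    mul_div_mul_right _ _ (pow_ne_zero m hg0)]

/-- `coordHom` evaluates at the `t j / t i`. By homogeneity this is the same as evaluation at `t`. -/
theorem subtype_comp_coordHom (t : Fin (n + 1) → F) (i : Fin (n + 1)) (hi : t i ≠ 0)
    (hi' : (MvPolynomial.X i : MvPolynomial (Fin (n + 1)) D).eval₂ D.subtype t ≠ 0) :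
    (modelRing D t i).subtype.comp (coordHom t i hi) = evalAway t (MvPolynomial.X i) hi' := by
  refine RingHom.ext fun z => ?_
  obtain ⟨m, a, ha, rfl⟩ := Away.mk_surjective (homogeneousPolys D n) (X_mem_homogeneousPolys i) z
  rw [evalAway_mk, MvPolynomial.eval₂_X]
  let g : MvPolynomial (Fin (n + 1)) D →+* modelRing D t i :=
    MvPolynomial.eval₂Hom (Subring.inclusion (le_modelRing i)) fun j =>
      ⟨t j / t i, div_mem_modelRing i j⟩
  have h1 : g (MvPolynomial.X i) = 1 := by
    simp only [g, MvPolynomial.eval₂Hom_X']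
    exact Subtype.ext (div_self hi)
  have hu : IsUnit (g (MvPolynomial.X i)) := by
    rw [h1]
    exact isUnit_one
  have h2 := lift_val_awayMk_mul (X_mem_homogeneousPolys i) g hu m a ha
  replace h2 := (by rw [h1, one_pow, mul_one] : _ = _ * g (MvPolynomial.X i) ^ m).trans h2
  refine (congrArg (modelRing D t i).subtype h2).trans ?_
  rw [MvPolynomial.coe_eval₂Hom, MvPolynomial.hom_eval₂]
  have h3 := MvPolynomial.IsHomogeneous.eval₂_mul
    ((MvPolynomial.mem_homogeneousSubmodule _ _).1 ha) D.subtype (t i)⁻¹ t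
  rw [smul_eq_mul, mul_one, inv_pow, ← div_eq_inv_mul] at h3
  rw [← h3]
  congr 1
  funext j
  exact div_eq_inv_mul _ _

/-- The degree zero part of `D[T_0, …, T_n]` localized at `T_i` is generated over `D` by the `T_j / T_i`:
a homogeneous `a` of degree `m` satisfies `a / T_i ^ m = a (T_0 / T_i, …, T_n / T_i)`. -/
theorem awayMk_eq_eval₂ (i : Fin (n + 1)) (m : ℕ) (a : MvPolynomial (Fin (n + 1)) D)
    (ha : a ∈ homogeneousPolys D n (m • 1)) :
    Away.mk _ (X_mem_homogeneousPolys i) m a ha =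
      a.eval₂ ((fromZeroRingHom (homogeneousPolys D n) (Submonoid.powers (MvPolynomial.X i))).comp
        (algebraMap D (homogeneousPolys D n 0))) fun j =>
          Away.mk _ (X_mem_homogeneousPolys i) 1 (MvPolynomial.X j)
            (by rw [one_smul]; exact X_mem_homogeneousPolys j) := by
  set f : MvPolynomial (Fin (n + 1)) D := MvPolynomial.X i
  apply HomogeneousLocalization.val_injective
  rw [← HomogeneousLocalization.algebraMap_apply, ← HomogeneousLocalization.algebraMap_apply,
    MvPolynomial.hom_eval₂]
  have h := MvPolynomial.IsHomogeneous.eval₂_mul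
    ((MvPolynomial.mem_homogeneousSubmodule _ _).1 ha)
    ((algebraMap (MvPolynomial (Fin (n + 1)) D) (Localization.Away f)).comp MvPolynomial.C)
    (Localization.mk 1 ⟨f, Submonoid.mem_powers f⟩) fun j =>
      algebraMap (MvPolynomial (Fin (n + 1)) D) (Localization.Away f) (MvPolynomial.X j)
  rw [← MvPolynomial.hom_eval₂, MvPolynomial.eval₂_eta, smul_eq_mul, mul_one] at h
  rw [HomogeneousLocalization.algebraMap_apply, Away.val_mk]
  refine Eq.trans ?_ (h.symm.trans ?_)
  · rw [Localization.mk_pow, ← Localization.mk_one_eq_algebraMap, Localization.mk_mul]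
    simp [f]
  · congr 1
    funext j
    simp only [HomogeneousLocalization.algebraMap_apply, Away.val_mk]
    rw [← Localization.mk_one_eq_algebraMap, Localization.mk_mul]
    simp [f]

/-- A ring homomorphism from `D[T_0 / T_i, …, T_n / T_i]` to `F` that fixes `D` is evaluation at the
images of the `T_j / T_i`. -/
theorem evalAway_eq {i : Fin (n + 1)} (ρ : Away (homogeneousPolys D n) (MvPolynomial.X i) →+* F)
    (hρ : ∀ c : D, ρ (fromZeroRingHom _ _ (algebraMap D (homogeneousPolys D n 0) c)) = c)
    (t : Fin (n + 1) → F) (ht : ∀ j, t j = ρ (Away.mk _ (X_mem_homogeneousPolys i) 1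
      (MvPolynomial.X j) (by rw [one_smul]; exact X_mem_homogeneousPolys j))) (h1 : t i = 1)
    (hi : (MvPolynomial.X i : MvPolynomial (Fin (n + 1)) D).eval₂ D.subtype t ≠ 0) :
    evalAway t (MvPolynomial.X i) hi = ρ := by
  refine RingHom.ext fun z => ?_
  obtain ⟨m, a, ha, rfl⟩ := Away.mk_surjective (homogeneousPolys D n) (X_mem_homogeneousPolys i) z
  rw [evalAway_mk, MvPolynomial.eval₂_X, h1, one_pow, div_one, awayMk_eq_eval₂,
    MvPolynomial.hom_eval₂]
  congr 1
  · exact RingHom.ext fun c => (hρ c).symm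
  · exact funext ht

theorem awayMk_X_self (i : Fin (n + 1)) :
    Away.mk (homogeneousPolys D n) (X_mem_homogeneousPolys i) 1 (MvPolynomial.X i)
      (by rw [one_smul]; exact X_mem_homogeneousPolys i) = 1 := by
  apply HomogeneousLocalization.val_injective
  rw [Away.val_mk, HomogeneousLocalization.val_one]
  simp only [pow_one]
  exact Localization.mk_self (⟨MvPolynomial.X i, Submonoid.mem_powers _⟩ :
    Submonoid.powers (MvPolynomial.X i : MvPolynomial (Fin (n + 1)) D))

theorem specField_comp_coordMorphism (t : Fin (n + 1) → F) (i : Fin (n + 1)) (hi : t i ≠ 0)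
    (hi' : (MvPolynomial.X i : MvPolynomial (Fin (n + 1)) D).eval₂ D.subtype t ≠ 0) :
    specField (modelRing D t i) ≫ coordMorphism t i hi =
      Spec.map (CommRingCat.ofHom (evalAway t (MvPolynomial.X i) hi')) ≫ stdChart D n i := by
  rw [← subtype_comp_coordHom t i hi hi', CommRingCat.ofHom_comp, Spec.map_comp_assoc]
  rfl

theorem eval₂_X_ne_zero {t : Fin (n + 1) → F} {i : Fin (n + 1)} (hi : t i ≠ 0) :
    (MvPolynomial.X i : MvPolynomial (Fin (n + 1)) D).eval₂ D.subtype t ≠ 0 := by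
  rwa [MvPolynomial.eval₂_X]

/-- Evaluation at `t` on the chart `T_i ≠ 0` factors through the chart `x = T_i T_j ≠ 0`. -/
theorem specMap_evalAway_comp_stdChart {t : Fin (n + 1) → F} {i j : Fin (n + 1)} (hi : t i ≠ 0)
    {x : MvPolynomial (Fin (n + 1)) D} (hx : x = MvPolynomial.X i * MvPolynomial.X j)
    (hx0 : x.eval₂ D.subtype t ≠ 0) (hd : x ∈ homogeneousPolys D n (1 + 1)) :
    Spec.map (CommRingCat.ofHom (evalAway t (MvPolynomial.X i) (eval₂_X_ne_zero hi))) ≫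
        stdChart D n i =
      Spec.map (CommRingCat.ofHom (evalAway t x hx0)) ≫
        Proj.awayι (homogeneousPolys D n) x hd (Nat.zero_lt_succ 1) := by
  rw [← evalAway_comp_awayMap t (X_mem_homogeneousPolys i) (X_mem_homogeneousPolys j) hx _ hx0,
    CommRingCat.ofHom_comp, Spec.map_comp_assoc]
  exact congrArg (_ ≫ ·) (Proj.SpecMap_awayMap_awayι (homogeneousPolys D n)
    (X_mem_homogeneousPolys i) Nat.one_pos (X_mem_homogeneousPolys j) hx)

/-- The point of projective space with homogeneous coordinates `t` does not depend on the chart. -/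
theorem specField_comp_coordMorphism_eq (t : Fin (n + 1) → F) (i j : Fin (n + 1)) (hi : t i ≠ 0)
    (hj : t j ≠ 0) :
    specField (modelRing D t i) ≫ coordMorphism t i hi =
      specField (modelRing D t j) ≫ coordMorphism t j hj := by
  have hij : (MvPolynomial.X i * MvPolynomial.X j : MvPolynomial (Fin (n + 1)) D).eval₂
      D.subtype t ≠ 0 := by
    rw [MvPolynomial.eval₂_mul, MvPolynomial.eval₂_X, MvPolynomial.eval₂_X]
    exact mul_ne_zero hi hj
  have hd : (MvPolynomial.X i * MvPolynomial.X j : MvPolynomial (Fin (n + 1)) D) ∈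
      homogeneousPolys D n (1 + 1) :=
    SetLike.mul_mem_graded (X_mem_homogeneousPolys i) (X_mem_homogeneousPolys j)
  rw [specField_comp_coordMorphism t i hi (eval₂_X_ne_zero hi),
    specField_comp_coordMorphism t j hj (eval₂_X_ne_zero hj),
    specMap_evalAway_comp_stdChart hi rfl hij hd,
    specMap_evalAway_comp_stdChart hj (mul_comm _ _) hij hd]

/-! ### Homogeneous coordinates of points of projective space -/

instance : (projSpace D n).IsSeparated :=
  inferInstanceAs (Proj (homogeneousPolys D n)).IsSeparated

theorem exists_mem_range_stdChart (y : projSpace D n) : ∃ i, y ∈ Set.range (stdChart D n i) := by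
  have h := Proj.iSup_basicOpen_eq_top' (homogeneousPolys D n)
    (fun i : Fin (n + 1) => (MvPolynomial.X i : MvPolynomial (Fin (n + 1)) D))
    (fun i => ⟨1, X_mem_homogeneousPolys i⟩) (by
      rw [eq_top_iff]
      rintro a -
      induction a using MvPolynomial.induction_on with
      | C c => exact Subalgebra.algebraMap_mem _ (⟨MvPolynomial.C c,
          (MvPolynomial.mem_homogeneousSubmodule _ _).2 (MvPolynomial.isHomogeneous_C _ c)⟩ :
            homogeneousPolys D n 0)
      | add p q hp hq => exact add_mem hp hq
      | mul_X p i hp => exact mul_mem hp (Algebra.subset_adjoin ⟨i, rfl⟩))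
  have hy : y ∈ ⨆ i, Proj.basicOpen (homogeneousPolys D n) (MvPolynomial.X i) := by
    rw [h]
    trivial
  obtain ⟨i, hi⟩ := Opens.mem_iSup.1 hy
  rw [← Proj.opensRange_awayι (homogeneousPolys D n) _ (X_mem_homogeneousPolys i) Nat.one_pos] at hi
  exact ⟨i, hi⟩

theorem stdChart_comp_projSpaceToSpec (i : Fin (n + 1)) :
    stdChart D n i ≫ projSpaceToSpec D n = Spec.map (CommRingCat.ofHom
      ((fromZeroRingHom (homogeneousPolys D n) (Submonoid.powers (MvPolynomial.X i))).comp
        (algebraMap D (homogeneousPolys D n 0)))) := by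
  refine (Category.assoc (stdChart D n i) (Proj.toSpecZero (homogeneousPolys D n)) _).symm.trans ?_
  refine (congrArg (· ≫ _) (Proj.awayι_toSpecZero (homogeneousPolys D n) _
    (X_mem_homogeneousPolys i) Nat.one_pos)).trans ?_
  exact (Spec.map_comp _ _).symm

/-- A `D`-morphism `Spec F → ℙ^n_D` is a point with homogeneous coordinates in `F`. -/
theorem exists_homogeneous_coordinates (G : Spec (CommRingCat.of F) ⟶ projSpace D n)
    (hG : G ≫ projSpaceToSpec D n = specField D) :
    ∃ (t : Fin (n + 1) → F) (i : Fin (n + 1)) (hi : t i ≠ 0),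
      specField (modelRing D t i) ≫ coordMorphism t i hi = G := by
  obtain ⟨i, hi⟩ := exists_mem_range_stdChart (G (IsLocalRing.closedPoint F))
  have : IsOpenImmersion (stdChart D n i) := inferInstanceAs (IsOpenImmersion (Proj.awayι _ _ _ _))
  have hr : Set.range G ⊆ Set.range (stdChart D n i) := by
    rintro _ ⟨x, rfl⟩
    rwa [show x = IsLocalRing.closedPoint F from
      Subsingleton.elim (α := PrimeSpectrum F) _ _]
  obtain ⟨ρ, hρ⟩ := Spec.map_surjective (IsOpenImmersion.lift (stdChart D n i) G hr)
  have hG' : Spec.map ρ ≫ stdChart D n i = G := by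
    rw [hρ, IsOpenImmersion.lift_fac]
  have hD : ∀ c : D, ρ.hom (fromZeroRingHom _ _ (algebraMap D (homogeneousPolys D n 0) c)) = c := by
    intro c
    rw [← hG', Category.assoc, stdChart_comp_projSpaceToSpec, ← Spec.map_comp, specField,
      Spec.map_inj] at hG
    exact congrArg (fun f => f.hom c) hG
  let t : Fin (n + 1) → F := fun j => ρ.hom (Away.mk _ (X_mem_homogeneousPolys i) 1
      (MvPolynomial.X j) (by rw [one_smul]; exact X_mem_homogeneousPolys j))
  have h1 : t i = 1 := by
    simp only [t]
    rw [awayMk_X_self, map_one]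
  have hi0 : t i ≠ 0 := by
    rw [h1]
    exact one_ne_zero
  refine ⟨t, i, hi0, ?_⟩
  rw [specField_comp_coordMorphism t i hi0 (eval₂_X_ne_zero hi0),
    evalAway_eq ρ.hom hD t (fun _ => rfl) h1]
  exact hG'

/-! ### The morphism from a projective model to projective space -/

variable {t : Fin (n + 1) → F}

/-- The morphism `Spec A → ℙ^n_D` with homogeneous coordinates `t`, for a subring `A` of `F` that
contains `D` and all `t j / t i`. -/
def coordMorphismOfLE (i : Fin (n + 1)) (hi : t i ≠ 0) (A : Subring F) (hA : modelRing D t i ≤ A) :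
    Spec (CommRingCat.of A) ⟶ projSpace D n :=
  Spec.map (CommRingCat.ofHom (Subring.inclusion hA)) ≫ coordMorphism t i hi

theorem specField_comp_coordMorphismOfLE (i : Fin (n + 1)) (hi : t i ≠ 0) (A : Subring F)
    (hA : modelRing D t i ≤ A) :
    specField A ≫ coordMorphismOfLE i hi A hA = specField (modelRing D t i) ≫ coordMorphism t i hi :=
  (Spec.map_comp_assoc _ _ _).symm

/-- The morphism does not depend on the chart, since it does not on `Spec F` and `ℙ^n_D` is separated. -/
theorem coordMorphismOfLE_eq {i j : Fin (n + 1)} (hi : t i ≠ 0) (hj : t j ≠ 0) (A : Subring F)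
    (hA : modelRing D t i ≤ A) (hA' : modelRing D t j ≤ A) :
    coordMorphismOfLE i hi A hA = coordMorphismOfLE j hj A hA' := by
  refine eq_of_specField_comp_eq ?_
  rw [specField_comp_coordMorphismOfLE, specField_comp_coordMorphismOfLE]
  exact specField_comp_coordMorphism_eq t i j hi hj

theorem exists_modelRing_le (R : Points (modelFamily D t)) :
    ∃ i, t i ≠ 0 ∧ modelRing D t i ≤ (modelFamily D t R).toSubring := by
  obtain ⟨_, i, hi, P, rfl⟩ := R
  exact ⟨i, hi, LocalSubring.le_ofPrime _ _⟩

/-- The morphism `Spec R → ℙ^n_D` with homogeneous coordinates `t`, for a local ring `R` in the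
projective model. -/
def modelPointMorphism (R : Points (modelFamily D t)) :
    Spec (CommRingCat.of (modelFamily D t R).toSubring) ⟶ projSpace D n :=
  coordMorphismOfLE (exists_modelRing_le R).choose (exists_modelRing_le R).choose_spec.1 _
    (exists_modelRing_le R).choose_spec.2

theorem modelPointMorphism_eq (R : Points (modelFamily D t)) {i : Fin (n + 1)} (hi : t i ≠ 0)
    (hR : modelRing D t i ≤ (modelFamily D t R).toSubring) :
    modelPointMorphism R = coordMorphismOfLE i hi _ hR :=
  coordMorphismOfLE_eq _ hi _ _ hR

theorem continuous_modelPointMorphism :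
    Continuous fun R : Points (modelFamily D t) =>
      modelPointMorphism R (IsLocalRing.closedPoint (modelFamily D t R).toSubring) := by
  refine continuous_def.2 fun V hV => isOpen_iff_forall_mem_open.2 fun R hRV => ?_
  obtain ⟨i, hi, hR⟩ := exists_modelRing_le R
  have key : ∀ (S : Points (modelFamily D t)) (hS : modelRing D t i ≤ (modelFamily D t S).toSubring),
      modelPointMorphism S (IsLocalRing.closedPoint (modelFamily D t S).toSubring) =
        coordMorphism t i hi (PrimeSpectrum.comap (Subring.inclusion hS)
          (IsLocalRing.closedPoint (modelFamily D t S).toSubring)) := fun S hS => by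
    rw [modelPointMorphism_eq S hi hS]
    rfl
  have hmem : coordMorphism t i hi (PrimeSpectrum.comap (Subring.inclusion hR)
      (IsLocalRing.closedPoint (modelFamily D t R).toSubring)) ∈ V := by
    rw [← key R hR]
    exact hRV
  obtain ⟨_, ⟨_, ⟨b, rfl⟩, rfl⟩, hb, hbV⟩ :=
    (PrimeSpectrum.isBasis_basic_opens (R := modelRing D t i)).exists_subset_of_mem_open hmem
      (hV.preimage (coordMorphism t i hi).continuous)
  -- `b` is outside the center of `R`, so it is a unit of `R`; its inverse cuts out the neighbourhood.
  obtain ⟨v, hv⟩ := (not_not.1 hb : IsUnit (Subring.inclusion hR b)).exists_right_inv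
  have hv' : (b : F) * v = 1 := congrArg Subtype.val hv
  refine ⟨(⋂ j, {S : Points (modelFamily D t) | t j / t i ∈ (modelFamily D t S).toSubring}) ∩
    {S | (v : F) ∈ (modelFamily D t S).toSubring}, fun S hS => ?_,
    (isOpen_iInter_of_finite fun j => isOpen_setOf_mem _ _).inter (isOpen_setOf_mem _ _),
    Set.mem_iInter.2 fun j => hR (div_mem_modelRing i j), v.2⟩
  have hDS : D ≤ (modelFamily D t S).toSubring := by
    obtain ⟨k, -, hk⟩ := exists_modelRing_le S
    exact (le_modelRing k).trans hk
  have hS' : modelRing D t i ≤ (modelFamily D t S).toSubring :=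
    modelRing_le hDS (Set.mem_iInter.1 hS.1)
  rw [Set.mem_preimage, key S hS']
  refine hbV fun hbS => hbS ?_
  exact IsUnit.of_mul_eq_one (⟨v, hS.2⟩ : (modelFamily D t S).toSubring) (Subtype.ext hv')

/-- The morphism `γ` from the projective model exists, and its generic morphism is the point of
projective space with homogeneous coordinates `t`. -/
theorem exists_isGluedFromCharts (ht : t ≠ 0) :
    ∃ γ : modelSpace D ht ⟶ (projSpace D n).toLocallyRingedSpace, IsGluedFromCharts ht γ ∧
      ∀ (i : Fin (n + 1)) (hi : t i ≠ 0) (R : Points (modelFamily D t)),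
        genericMorphism γ R = specField (modelRing D t i) ≫ coordMorphism t i hi := by
  obtain ⟨j, hj⟩ := Function.ne_iff.1 ht
  let γ : modelSpace D ht ⟶ (projSpace D n).toLocallyRingedSpace :=
    ofPointMorphisms (specField (modelRing D t j) ≫ coordMorphism t j hj) modelPointMorphism
      (fun R => by
        rw [modelPointMorphism, specField_comp_coordMorphismOfLE]
        exact specField_comp_coordMorphism_eq t _ j _ hj) continuous_modelPointMorphism
  have hγ : ∀ (i : Fin (n + 1)) (hi : t i ≠ 0) (R : Points (modelFamily D t)),
      genericMorphism γ R = specField (modelRing D t i) ≫ coordMorphism t i hi := by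
    intro i hi R
    rw [genericMorphism, pointMorphism_ofPointMorphisms, modelPointMorphism,
      specField_comp_coordMorphismOfLE]
    exact specField_comp_coordMorphism_eq t _ i _ hi
  refine ⟨γ, fun i hi => ?_, hγ⟩
  refine congrArg Scheme.Hom.toLRSHom (a₁ := Scheme.Hom.mk (modelChart ht i hi ≫ γ)) ?_
  refine eq_of_specField_comp_eq ?_
  exact (specField_comp_specHom (modelRing D t i) _ _ γ ⊥ _ rfl).trans (hγ i hi _)

end ProjectiveSpace

end

theorem proposition2p3 {F : Type u} [Field F] (D : Subring F) (Z : Set (ValuationSubring F))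
    (hZ : Z ⊆ zariskiRiemann D) (hF : ⊤ ∈ Z) (n : ℕ)
    (φ : zariskiSpace Z hF ⟶ (projSpace D n).toLocallyRingedSpace)
    (hφ : φ ≫ (projSpaceToSpec D n).toLRSHom = zariskiToSpec hZ hF) :
    ∃ t : Fin (n + 1) → F, IsMorphismDefinedBy hZ hF t φ := by
  let η : LocalRingSpace.Points (zariskiFamily Z) := ⟨⊤, hF⟩
  obtain ⟨t, i, hi, hG⟩ := exists_homogeneous_coordinates (LocalRingSpace.genericMorphism φ η) (by
    rw [← LocalRingSpace.genericMorphism_comp, hφ]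
    exact LocalRingSpace.genericMorphism_centerHom D (fun V => hZ V.2) η)
  have ht : t ≠ 0 := fun h => hi (congrFun h i)
  obtain ⟨γ, hγ, hγ'⟩ := exists_isGluedFromCharts (D := D) ht
  refine ⟨t, ht, γ, hγ, LocalRingSpace.ext_genericMorphism η ?_⟩
  rw [← hG, ← hγ' i hi (dominatedPoint ht hZ η)]
  exact (LocalRingSpace.genericMorphism_dominationHom_comp
    (hr := zariskiFamily_hasGenericPoint hF) (hq := modelFamily_hasGenericPoint ht)
    ⟨dominatedPoint ht hZ, continuous_dominatedPoint ht hZ⟩ (dominatedPoint_le ht hZ) γ η).symm
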